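/- Let $n\ge 1$ and let $H=-\Delta+|x|^2$ be the Hermite operator on $\mathbb{R}^n$. For $f\in L^2(\mathbb{R}^n)$ and $s\in\mathbb{R}$ let $e^{-isH}f=\sum_{\mu}e^{-is\mu}P_\mu f$ (convergence in $L^2$), where $P_\mu$ is the orthogonal projection of $L^2(\mathbb{R}^n)$ onto the eigenspace $\{g\in L^2(\mathbb{R}^n): Hg=\mu g\}$ and $Hg$ is taken in the sense of tempered distributions. Let $f\in L^2(\mathbb{R}^n)$ and $u(\cdot,s)=e^{-isH}f$. Then $u$ is the unique solution in $C(\mathbb{R};L^2(\mathbb{R}^n))$ of the Schrödinger equation $$ i\,\partial_s u(x,s)-Hu(x,s)=0,\qquad u(x,0)=f(x), $$ where the equation is understood in the sense of tempered distributions in $x$: for every Schwartz function $\varphi$ and every $s$, $i\,\frac{d}{ds}\int u(x,s)\varphi(x)\,dx=\int u(x,s)\,(H\varphi)(x)\,dx$. Moreover, let $a,b>0$ and $s_0\in\mathbb{R}$, and suppose that, as $|x|\to\infty$ (for almost every $x$), $$ |f(x)|=O\!\left(e^{-a|x|^2}\right),\qquad |u(x,s_0)|=O\!\left(e^{-b|x|^2}\right).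 $$ If $ab\,\sin^2(2s_0)>\tfrac14$, then $u=0$ on $\mathbb{R}^n\times\mathbb{R}$, that is, $u(\cdot,s)=0$ in $L^2(\mathbb{R}^n)$ for every $s\in\mathbb{R}$. -/

import Mathlib

open MeasureTheory Filter Asymptotics
open scoped SchwartzMap Laplacian

noncomputable section

/-- Euclidean space `ℝⁿ`. -/
abbrev Rn (n : ℕ) : Type := EuclideanSpace ℝ (Fin n)

/-- The complex Hilbert space `L²(ℝⁿ)` for Lebesgue measure. -/
abbrev L2 (n : ℕ) : Type := Lp ℂ 2 (volume : Measure (Rn n))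

/-- The inclusion `L²(ℝⁿ) ⊆ 𝓢'(ℝⁿ)`, sending `g` to the distribution `φ ↦ ∫ φ(x) g(x) dx`. -/
def toDistrib (n : ℕ) : L2 n →L[ℂ] 𝓢'(Rn n, ℂ) :=
  Lp.toTemperedDistributionCLM ℂ (volume : Measure (Rn n)) 2

/-- The Hermite operator `H = -Δ + |x|²` acting on tempered distributions on `ℝⁿ`. -/
def hermiteOp (n : ℕ) (T : 𝓢'(Rn n, ℂ)) : 𝓢'(Rn n, ℂ) :=
  -(Δ T) + TemperedDistribution.smulLeftCLM ℂ (fun x : Rn n => ((‖x‖ ^ 2 : ℝ) : ℂ)) T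

/-- `H` tested against a Schwartz function. -/
theorem hermiteOp_apply (n : ℕ) (T : 𝓢'(Rn n, ℂ)) (φ : 𝓢(Rn n, ℂ)) :
    hermiteOp n T φ =
      -(T (Δ φ)) + T (SchwartzMap.smulLeftCLM ℂ (fun x : Rn n => ((‖x‖ ^ 2 : ℝ) : ℂ)) φ) := by
  rw [← TemperedDistribution.laplacian_apply_apply]
  rfl

/-- The eigenspace `{g ∈ L²(ℝⁿ) : H g = μ g}` of the Hermite operator. -/
def hermiteEigenspace (n : ℕ) (μ : ℝ) : Submodule ℂ (L2 n) where
  carrier := {g | hermiteOp n (toDistrib n g) = (μ : ℂ) • toDistrib n g}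
  zero_mem' := by
    ext φ
    simp [hermiteOp_apply]
  add_mem' := by
    intro g h hg hh
    ext φ
    have h1 := congrArg (fun T : 𝓢'(Rn n, ℂ) => T φ) hg
    have h2 := congrArg (fun T : 𝓢'(Rn n, ℂ) => T φ) hh
    simp [hermiteOp_apply] at h1 h2 ⊢
    linear_combination h1 + h2
  smul_mem' := by
    intro c g hg
    ext φ
    have h1 := congrArg (fun T : 𝓢'(Rn n, ℂ) => T φ) hg
    simp [hermiteOp_apply] at h1 ⊢
    linear_combination c * h1

theorem isClosed_hermiteEigenspace (n : ℕ) (μ : ℝ) :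
    IsClosed (hermiteEigenspace n μ : Set (L2 n)) := by
  have hc (ψ : 𝓢(Rn n, ℂ)) : Continuous fun g : L2 n => toDistrib n g ψ :=
    (PointwiseConvergenceCLM.evalCLM (RingHom.id ℂ) ℂ ψ).continuous.comp (toDistrib n).continuous
  have key : (hermiteEigenspace n μ : Set (L2 n)) =
      ⋂ φ : 𝓢(Rn n, ℂ), {g | hermiteOp n (toDistrib n g) φ = (μ : ℂ) * toDistrib n g φ} := by
    ext g
    simp only [Set.mem_iInter, Set.mem_ofPred_eq]
    constructor
    · intro hg φ
      exact congrArg (fun T : 𝓢'(Rn n, ℂ) => T φ) hg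
    · intro hg
      change hermiteOp n (toDistrib n g) = (μ : ℂ) • toDistrib n g
      ext φ
      exact hg φ
  rw [key]
  refine isClosed_iInter fun φ => isClosed_eq ?_ (continuous_const.mul (hc φ))
  simp only [hermiteOp_apply]
  exact (hc _).neg.add (hc _)

instance instCompleteSpaceHermiteEigenspace (n : ℕ) (μ : ℝ) :
    CompleteSpace (hermiteEigenspace n μ) :=
  (isClosed_hermiteEigenspace n μ).completeSpace_coe

/-- The operator `e^{-isH}` on `L²(ℝⁿ)`, through the spectral resolution of the Hermite operator
(which has pure point spectrum): `e^{-isH} f = ∑_μ e^{-isμ} P_μ f`, where `P_μ` is the orthogonal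
projection of `L²(ℝⁿ)` onto the `μ`-eigenspace of `H`; only countably many of these eigenspaces
are nonzero. -/
def hermiteSchrodinger (n : ℕ) (s : ℝ) (f : L2 n) : L2 n :=
  ∑' μ : ℝ, Complex.exp (-(Complex.I * s * μ)) • (hermiteEigenspace n μ).starProjection f

/-- `u` is a solution in `C(ℝ, L²(ℝⁿ))` of the Schrödinger equation `i ∂ₛu - Hu = 0`, understood
in the sense of tempered distributions in the space variable, with initial condition `f`. -/
structure IsSchrodingerSolution {n : ℕ} (f : L2 n) (u : ℝ → L2 n) : Prop where
  continuous : Continuous u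
  equation : ∀ (φ : 𝓢(Rn n, ℂ)) (s : ℝ), HasDerivAt (fun t => toDistrib n (u t) φ)
    (-Complex.I * hermiteOp n (toDistrib n (u s)) φ) s
  initial : u 0 = f

/-- `|g(x)| = O(e^{-c|x|²})` as `|x| → ∞`, for (an almost everywhere class) `g`: there are `C` and
`R` such that `|g(x)| ≤ C e^{-c|x|²}` for almost every `x` with `|x| ≥ R`. -/
def HasGaussianDecay {n : ℕ} (c : ℝ) (g : L2 n) : Prop :=
  (g : Rn n → ℂ) =O[Bornology.cobounded (Rn n) ⊓ ae volume] fun x => Real.exp (-c * ‖x‖ ^ 2)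

end

open scoped LineDeriv FourierTransform ContDiff Topology

noncomputable section

/-! The vanishing statement is complex analysis of the Bargmann transform. Pairing `f` with the
states `coherentState η z`, for a unit vector η, gives an entire function F of z. On coherent states
H acts as n + 2z d/dz, so e^{-isH} acts on F by the rotation z ↦ e^{-2is}z, up to a unimodular
factor (`pairing_hermitePropagator_coherentState`). Gaussian decay of `f` at rate a becomes |F(z)| ≤
C exp(p|z|² - Re(σz²)) with p = 1/(2a+1) and σ = 1-p (`norm_toDistrib_coherentState_le`). Decay at
time s₀ gives the same with q = 1/(2b+1) and τ = (1-q)e^{4is₀}. If |σ-τ| > p+q, the two bounds are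
incompatible unless F = 0, by Phragmén–Lindelöf (`eq_zero_of_two_gaussian_bounds`). Since |σ-τ|² =
(p-q)² + 4(1-p)(1-q)sin²(2s₀), 1-p = 2ap and 1-q = 2bq, this condition is exactly ab sin²(2s₀) >
1/4. When F = 0 for every η, the Fourier transform of `f` times a Gaussian vanishes, hence f = 0.

The Cauchy problem rests on the totality of the Schwartz eigenfunctions
(`eq_zero_of_toDistrib_hermiteSpan`): ladder operators put the powers of ⟪x, ξ⟫ times the Gaussian
into their span, and the exponential series then reaches the coherent states at z = i. Totality
makes the L² eigenspaces orthogonal with dense span, so e^{-isH} is a well-defined contraction. It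
solves the equation on finite sums of eigenvectors, and uniform limits give the general case.
Uniqueness follows by testing a solution on Schwartz eigenfunctions. -/

/-! ### Exponentials of quadratic type as Schwartz functions -/

theorem norm_iteratedFDeriv_real_cexp (i : ℕ) (w : ℂ) :
    ‖iteratedFDeriv ℝ i Complex.exp w‖ = Real.exp w.re := by
  have h := ((Complex.contDiff_exp (𝕜 := ℂ) (n := i)).contDiffAt
    (x := w)).restrictScalars_iteratedFDeriv (𝕜 := ℝ)
  simp only [Function.comp_apply] at h
  rw [← h]
  change ‖ContinuousMultilinearMap.restrictScalars ℝ (iteratedFDeriv ℂ i Complex.exp w)‖ = _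
  rw [ContinuousMultilinearMap.norm_restrictScalars, norm_iteratedFDeriv_eq_norm_iteratedDeriv,
    iteratedDeriv_eq_iterate, Complex.iter_deriv_exp, Complex.norm_exp]

theorem exists_pow_mul_exp_neg_mul_sq_le (m : ℕ) {c : ℝ} (hc : 0 < c) :
    ∃ M : ℝ, ∀ r : ℝ, 0 ≤ r → (1 + r) ^ m * Real.exp (-c * r ^ 2) ≤ M := by
  refine ⟨(m.factorial : ℝ) * Real.exp (1 + 1 / (4 * c)), fun r hr => ?_⟩
  have h1 : (1 + r) ^ m / (m.factorial : ℝ) ≤ Real.exp (1 + r) :=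
    Real.pow_div_factorial_le_exp _ (by positivity) m
  have h2 : (1 + r) ^ m ≤ m.factorial * Real.exp (1 + r) := by
    rwa [div_le_iff₀' (by positivity)] at h1
  calc (1 + r) ^ m * Real.exp (-c * r ^ 2)
      ≤ m.factorial * Real.exp (1 + r) * Real.exp (-c * r ^ 2) := by gcongr
    _ = m.factorial * Real.exp (1 + r + -c * r ^ 2) := by rw [mul_assoc, ← Real.exp_add]
    _ ≤ _ := by
      refine mul_le_mul_of_nonneg_left (Real.exp_le_exp.2 ?_) (by positivity)
      have : r - c * r ^ 2 ≤ 1 / (4 * c) := by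
        rw [le_div_iff₀ (by positivity)]
        nlinarith [sq_nonneg (2 * c * r - 1)]
      linarith only [this]

/-- The exponential of a function of temperate growth whose real part tends to `-∞` at least
quadratically, as a Schwartz function. -/
def schwartzExp {n : ℕ} (q : Rn n → ℂ) (hq : q.HasTemperateGrowth)
    (hre : ∃ c > 0, ∃ C : ℝ, ∀ x, (q x).re ≤ C - c * ‖x‖ ^ 2) : 𝓢(Rn n, ℂ) where
  toFun x := Complex.exp (q x)
  smooth' := by
    have := hq.1
    fun_prop
  decay' := by
    intro k m
    obtain ⟨c, hc, C, hC⟩ := hre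
    obtain ⟨l, D, hD0, hD⟩ := hq.norm_iteratedFDeriv_le_uniform m
    obtain ⟨M, hM⟩ := exists_pow_mul_exp_neg_mul_sq_le (k + l * m) hc
    refine ⟨m.factorial * Real.exp C * (1 + D) ^ m * M, fun x => ?_⟩
    have key := norm_iteratedFDeriv_comp_le (𝕜 := ℝ) (g := Complex.exp) (f := q) (n := m)
      (N := m) (C := Real.exp (C - c * ‖x‖ ^ 2)) (D := (1 + D) * (1 + ‖x‖) ^ l)
      Complex.contDiff_exp (hq.1.of_le (mod_cast le_top)) le_rfl x
      (fun i _ => by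
        rw [norm_iteratedFDeriv_real_cexp]
        exact Real.exp_le_exp.2 (hC x))
      (fun i hi him => by
        refine (hD i him x).trans ?_
        have h1 : D * (1 + ‖x‖) ^ l ≤ (1 + D) * (1 + ‖x‖) ^ l := by gcongr; linarith
        refine h1.trans (le_self_pow₀ ?_ (by omega))
        have h2 : 1 ≤ (1 + ‖x‖) ^ l := one_le_pow₀ (by linarith [norm_nonneg x])
        nlinarith)
    have e : (fun x => Complex.exp (q x)) = Complex.exp ∘ q := rfl
    rw [e]
    calc ‖x‖ ^ k * ‖iteratedFDeriv ℝ m (Complex.exp ∘ q) x‖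
        ≤ (1 + ‖x‖) ^ k * (m.factorial * Real.exp (C - c * ‖x‖ ^ 2) *
            ((1 + D) * (1 + ‖x‖) ^ l) ^ m) := by
          gcongr
          linarith [norm_nonneg x]
      _ = m.factorial * Real.exp C * (1 + D) ^ m *
            ((1 + ‖x‖) ^ (k + l * m) * Real.exp (-c * ‖x‖ ^ 2)) := by
          rw [sub_eq_add_neg, Real.exp_add, mul_pow, ← pow_mul, pow_add, neg_mul]
          ring
      _ ≤ _ := by
          gcongr
          exact hM _ (norm_nonneg x)

/-! ### Commutation relations and ladder operators -/

/-- Multiplication of Schwartz functions by the linear form `x ↦ ⟪x, ξ⟫`. -/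
def mulInner {n : ℕ} (ξ : Rn n) : 𝓢(Rn n, ℂ) →L[ℂ] 𝓢(Rn n, ℂ) :=
  SchwartzMap.smulLeftCLM ℂ fun x : Rn n => ((inner ℝ x ξ : ℝ) : ℂ)

/-- The Hermite operator on Schwartz functions. -/
def hermiteSchwartz (n : ℕ) : 𝓢(Rn n, ℂ) →L[ℂ] 𝓢(Rn n, ℂ) :=
  -LineDeriv.laplacianCLM ℂ (Rn n) 𝓢(Rn n, ℂ) +
    SchwartzMap.smulLeftCLM ℂ fun x : Rn n => ((‖x‖ ^ 2 : ℝ) : ℂ)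

theorem hasTemperateGrowth_inner {n : ℕ} (ξ : Rn n) :
    (fun x : Rn n => ((inner ℝ x ξ : ℝ) : ℂ)).HasTemperateGrowth :=
  Function.Complex.hasTemperateGrowth_ofReal.comp (Function.hasTemperateGrowth_inner_left ξ)

theorem hasTemperateGrowth_normSq (n : ℕ) :
    (fun x : Rn n => ((‖x‖ ^ 2 : ℝ) : ℂ)).HasTemperateGrowth :=
  Function.Complex.hasTemperateGrowth_ofReal.comp (Function.hasTemperateGrowth_norm_sq (Rn n))

theorem mulInner_apply {n : ℕ} (ξ : Rn n) (φ : 𝓢(Rn n, ℂ)) (x : Rn n) :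
    mulInner ξ φ x = ((inner ℝ x ξ : ℝ) : ℂ) * φ x := by
  rw [mulInner, SchwartzMap.smulLeftCLM_apply_apply (hasTemperateGrowth_inner ξ), smul_eq_mul]

theorem hermiteSchwartz_eq {n : ℕ} (φ : 𝓢(Rn n, ℂ)) :
    hermiteSchwartz n φ = -(Δ φ) +
      SchwartzMap.smulLeftCLM ℂ (fun x : Rn n => ((‖x‖ ^ 2 : ℝ) : ℂ)) φ := by
  rw [← SchwartzMap.laplacianCLM_eq ℂ]
  rfl

theorem hermiteSchwartz_apply {n : ℕ} (φ : 𝓢(Rn n, ℂ)) (x : Rn n) :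
    hermiteSchwartz n φ x = -(Δ φ) x + ((‖x‖ ^ 2 : ℝ) : ℂ) * φ x := by
  rw [hermiteSchwartz_eq, add_apply,
    SchwartzMap.smulLeftCLM_apply_apply (hasTemperateGrowth_normSq n), smul_eq_mul]
  rfl

theorem hermiteOp_eq {n : ℕ} (T : 𝓢'(Rn n, ℂ)) (φ : 𝓢(Rn n, ℂ)) :
    hermiteOp n T φ = T (hermiteSchwartz n φ) := by
  rw [hermiteOp_apply, hermiteSchwartz_eq, map_add, map_neg]

theorem lineDerivOp_apply_fderiv {n : ℕ} (v : Rn n) (φ : 𝓢(Rn n, ℂ)) (x : Rn n) :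
    (∂_{v} φ) x = fderiv ℝ φ x v := SchwartzMap.lineDerivOp_apply_eq_fderiv v φ x

theorem lineDerivOp_mulInner {n : ℕ} (v ξ : Rn n) (φ : 𝓢(Rn n, ℂ)) :
    ∂_{v} (mulInner ξ φ) = (inner ℝ v ξ : ℝ) • φ + mulInner ξ (∂_{v} φ) := by
  ext x
  have h1 : HasFDerivAt (fun y : Rn n => ((inner ℝ y ξ : ℝ) : ℂ))
      (Complex.ofRealCLM ∘L (innerSL ℝ ξ)) x := by
    have := (Complex.ofRealCLM ∘L (innerSL ℝ ξ)).hasFDerivAt (x := x)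
    refine this.congr_of_eventuallyEq (Eventually.of_forall fun y => ?_)
    simp [real_inner_comm]
  have h2 := h1.fun_mul (φ.hasFDerivAt x)
  have e : (mulInner ξ φ : Rn n → ℂ) = fun y => ((inner ℝ y ξ : ℝ) : ℂ) * φ y :=
    funext fun y => mulInner_apply ξ φ y
  rw [add_apply, smul_apply, mulInner_apply, lineDerivOp_apply_fderiv,
    lineDerivOp_apply_fderiv, e, HasFDerivAt.fderiv h2]
  simp [real_inner_comm]
  ring

theorem lineDerivOp_smulLeft_normSq {n : ℕ} (v : Rn n) (φ : 𝓢(Rn n, ℂ)) :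
    ∂_{v} (SchwartzMap.smulLeftCLM ℂ (fun x : Rn n => ((‖x‖ ^ 2 : ℝ) : ℂ)) φ) =
      (2 : ℝ) • mulInner v φ +
        SchwartzMap.smulLeftCLM ℂ (fun x : Rn n => ((‖x‖ ^ 2 : ℝ) : ℂ)) (∂_{v} φ) := by
  ext x
  have h1 : HasFDerivAt (fun y : Rn n => ((‖y‖ ^ 2 : ℝ) : ℂ))
      (Complex.ofRealCLM ∘L (2 • innerSL ℝ x)) x :=
    Complex.ofRealCLM.hasFDerivAt.comp x (hasStrictFDerivAt_norm_sq x).hasFDerivAt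
  have h2 := h1.fun_mul (φ.hasFDerivAt x)
  have e : (SchwartzMap.smulLeftCLM ℂ (fun x : Rn n => ((‖x‖ ^ 2 : ℝ) : ℂ)) φ : Rn n → ℂ) =
      fun y => ((‖y‖ ^ 2 : ℝ) : ℂ) * φ y :=
    SchwartzMap.smulLeftCLM_apply (hasTemperateGrowth_normSq n) φ
  rw [add_apply, smul_apply, mulInner_apply, lineDerivOp_apply_fderiv,
    SchwartzMap.smulLeftCLM_apply_apply (hasTemperateGrowth_normSq n),
    lineDerivOp_apply_fderiv, e, HasFDerivAt.fderiv h2]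
  simp
  ring

theorem lineDerivOp_comm {n : ℕ} (v w : Rn n) (φ : 𝓢(Rn n, ℂ)) :
    ∂_{v} (∂_{w} φ) = ∂_{w} (∂_{v} φ) := by
  ext x
  have hd : DifferentiableAt ℝ (fderiv ℝ φ) x :=
    (SchwartzMap.fderivCLM ℝ (Rn n) ℂ φ).differentiableAt (x := x)
  have key (u : Rn n) : ((∂_{u} φ : 𝓢(Rn n, ℂ)) : Rn n → ℂ) = fun y => fderiv ℝ φ y u :=
    funext fun y => lineDerivOp_apply_fderiv u φ y
  have h2 (u : Rn n) : fderiv ℝ (fun y => fderiv ℝ φ y u) x =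
      (fderiv ℝ (fderiv ℝ φ) x).flip u := by
    have := hd.hasFDerivAt.clm_apply (hasFDerivAt_const u x)
    rw [this.fderiv]
    ext; simp
  rw [lineDerivOp_apply_fderiv, lineDerivOp_apply_fderiv, key, key, h2, h2]
  have hs : IsSymmSndFDerivAt ℝ φ x :=
    ContDiffAt.isSymmSndFDerivAt ((φ.smooth 2).contDiffAt) (by simp)
  exact hs v w

theorem laplacian_lineDerivOp {n : ℕ} (v : Rn n) (φ : 𝓢(Rn n, ℂ)) :
    Δ (∂_{v} φ) = ∂_{v} (Δ φ) := by
  rw [SchwartzMap.laplacian_eq_sum (EuclideanSpace.basisFun (Fin n) ℝ),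
    SchwartzMap.laplacian_eq_sum (EuclideanSpace.basisFun (Fin n) ℝ), LineDeriv.lineDerivOp_sum]
  refine Finset.sum_congr rfl fun i _ => ?_
  rw [lineDerivOp_comm _ v, lineDerivOp_comm _ v]

theorem laplacian_mulInner {n : ℕ} (ξ : Rn n) (φ : 𝓢(Rn n, ℂ)) :
    Δ (mulInner ξ φ) = (2 : ℝ) • ∂_{ξ} φ + mulInner ξ (Δ φ) := by
  set b := EuclideanSpace.basisFun (Fin n) ℝ
  have h : ∂_{ξ} φ = ∑ i, (inner ℝ (b i) ξ : ℝ) • ∂_{b i} φ := by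
    conv_lhs => rw [← b.sum_repr' ξ]
    rw [LineDeriv.lineDerivOp_left_sum]
    simp only [LineDeriv.lineDerivOp_left_smul]
  rw [h, SchwartzMap.laplacian_eq_sum b, SchwartzMap.laplacian_eq_sum b, map_sum,
    Finset.smul_sum, ← Finset.sum_add_distrib]
  refine Finset.sum_congr rfl fun i _ => ?_
  rw [lineDerivOp_mulInner, LineDeriv.lineDerivOp_add, LineDeriv.lineDerivOp_smul,
    lineDerivOp_mulInner, two_smul, add_assoc]

theorem hermiteSchwartz_mulInner {n : ℕ} (ξ : Rn n) (φ : 𝓢(Rn n, ℂ)) :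
    hermiteSchwartz n (mulInner ξ φ) =
      mulInner ξ (hermiteSchwartz n φ) - (2 : ℝ) • ∂_{ξ} φ := by
  have hc : SchwartzMap.smulLeftCLM ℂ (fun x : Rn n => ((‖x‖ ^ 2 : ℝ) : ℂ)) (mulInner ξ φ) =
      mulInner ξ (SchwartzMap.smulLeftCLM ℂ (fun x : Rn n => ((‖x‖ ^ 2 : ℝ) : ℂ)) φ) := by
    ext x
    simp only [mulInner_apply, SchwartzMap.smulLeftCLM_apply_apply (hasTemperateGrowth_normSq n),
      smul_eq_mul]
    ring
  rw [hermiteSchwartz_eq, hermiteSchwartz_eq, laplacian_mulInner, hc, map_add, map_neg]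
  abel

theorem hermiteSchwartz_lineDerivOp {n : ℕ} (ξ : Rn n) (φ : 𝓢(Rn n, ℂ)) :
    hermiteSchwartz n (∂_{ξ} φ) = ∂_{ξ} (hermiteSchwartz n φ) - (2 : ℝ) • mulInner ξ φ := by
  rw [hermiteSchwartz_eq, hermiteSchwartz_eq, laplacian_lineDerivOp, LineDeriv.lineDerivOp_add,
    lineDerivOp_smulLeft_normSq, LineDeriv.lineDerivOp_neg]
  abel

/-- The span of the Schwartz eigenfunctions of the Hermite operator. -/
def hermiteSpan (n : ℕ) : Submodule ℂ 𝓢(Rn n, ℂ) :=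
  Submodule.span ℂ {φ | ∃ μ : ℝ, hermiteSchwartz n φ = (μ : ℂ) • φ}

/-- The commutators [H, x·ξ] = -2∂_ξ and [H, ∂_ξ] = -2x·ξ make x·ξ - ∂_ξ and x·ξ + ∂_ξ raise and
lower the eigenvalue by 2; x·ξ is half their sum. -/
theorem mulInner_mem_hermiteSpan {n : ℕ} (ξ : Rn n) {φ : 𝓢(Rn n, ℂ)} (hφ : φ ∈ hermiteSpan n) :
    mulInner ξ φ ∈ hermiteSpan n := by
  induction hφ using Submodule.span_induction with
  | zero => simp
  | add x y _ _ hx hy => rw [map_add]; exact add_mem hx hy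
  | smul a x _ hx => rw [map_smul]; exact Submodule.smul_mem _ _ hx
  | mem φ h =>
    obtain ⟨μ, hμ⟩ := h
    have h1 : mulInner ξ φ - ∂_{ξ} φ ∈ hermiteSpan n := by
      refine Submodule.subset_span ⟨μ + 2, ?_⟩
      rw [map_sub, hermiteSchwartz_mulInner, hermiteSchwartz_lineDerivOp, hμ, map_smul,
        LineDeriv.lineDerivOp_smul]
      ext x
      simp only [sub_apply, smul_apply, smul_eq_mul, Complex.real_smul]
      push_cast
      ring
    have h2 : mulInner ξ φ + ∂_{ξ} φ ∈ hermiteSpan n := by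
      refine Submodule.subset_span ⟨μ - 2, ?_⟩
      rw [map_add, hermiteSchwartz_mulInner, hermiteSchwartz_lineDerivOp, hμ, map_smul,
        LineDeriv.lineDerivOp_smul]
      ext x
      simp only [sub_apply, add_apply, smul_apply, smul_eq_mul, Complex.real_smul]
      push_cast
      ring
    have h3 : mulInner ξ φ =
        (1 / 2 : ℂ) • ((mulInner ξ φ - ∂_{ξ} φ) + (mulInner ξ φ + ∂_{ξ} φ)) := by
      ext x
      simp only [sub_apply, add_apply, smul_apply, smul_eq_mul]
      ring
    rw [h3]
    exact Submodule.smul_mem _ _ (add_mem h1 h2)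

/-! ### Coherent states -/

/-- The exponent of the coherent state. -/
def coherentExponent {n : ℕ} (ξ : Rn n) (z : ℂ) (x : Rn n) : ℂ :=
  -((‖x‖ ^ 2 : ℝ) : ℂ) / 2 + 2 * z * ((inner ℝ x ξ : ℝ) : ℂ) - z ^ 2 * ((‖ξ‖ ^ 2 : ℝ) : ℂ)

theorem coherentExponent_re {n : ℕ} (ξ : Rn n) (z : ℂ) (x : Rn n) :
    (coherentExponent ξ z x).re =
      -‖x‖ ^ 2 / 2 + 2 * z.re * inner ℝ x ξ - (z ^ 2).re * ‖ξ‖ ^ 2 := by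
  rw [coherentExponent, Complex.sub_re, Complex.add_re, Complex.re_mul_ofReal,
    Complex.re_mul_ofReal]
  simp [-Complex.ofReal_pow]

theorem hasTemperateGrowth_coherentExponent {n : ℕ} (ξ : Rn n) (z : ℂ) :
    (coherentExponent ξ z).HasTemperateGrowth := by
  have h1 := hasTemperateGrowth_normSq n
  have h2 := hasTemperateGrowth_inner ξ
  have e : coherentExponent ξ z = fun x : Rn n => (-1 / 2 : ℂ) * ((‖x‖ ^ 2 : ℝ) : ℂ) +
      2 * z * ((inner ℝ x ξ : ℝ) : ℂ) - z ^ 2 * ((‖ξ‖ ^ 2 : ℝ) : ℂ) := by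
    funext x
    rw [coherentExponent]
    ring
  rw [e]
  exact (((Function.HasTemperateGrowth.const _).mul h1).add
    ((Function.HasTemperateGrowth.const _).mul h2)).sub (Function.HasTemperateGrowth.const _)

/-- The coherent state `x ↦ exp (-|x|²/2 + 2 z ⟪x, ξ⟫ - z² |ξ|²)`, the generating function of the
Hermite functions. -/
def coherentState {n : ℕ} (ξ : Rn n) (z : ℂ) : 𝓢(Rn n, ℂ) :=
  schwartzExp (coherentExponent ξ z) (hasTemperateGrowth_coherentExponent ξ z) (by
    refine ⟨1 / 4, by norm_num, 4 * (z.re * ‖ξ‖) ^ 2 - (z ^ 2).re * ‖ξ‖ ^ 2, fun x => ?_⟩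
    rw [coherentExponent_re]
    have h1 : |z.re * inner ℝ x ξ| ≤ |z.re| * (‖x‖ * ‖ξ‖) := by
      rw [abs_mul]; gcongr; exact abs_real_inner_le_norm x ξ
    have h2 := (le_abs_self _).trans h1
    have h3 : (|z.re| * ‖ξ‖) ^ 2 = (z.re * ‖ξ‖) ^ 2 := by rw [mul_pow, mul_pow, sq_abs]
    nlinarith [sq_nonneg (‖x‖ / 2 - 2 * (|z.re| * ‖ξ‖))])

theorem coherentState_apply {n : ℕ} (ξ : Rn n) (z : ℂ) (x : Rn n) :
    coherentState ξ z x = Complex.exp (coherentExponent ξ z x) := rfl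

theorem lineDerivOp_coherentState {n : ℕ} (v ξ : Rn n) (z : ℂ) :
    ∂_{v} (coherentState ξ z) =
      (2 * z * ((inner ℝ v ξ : ℝ) : ℂ)) • coherentState ξ z - mulInner v (coherentState ξ z) := by
  ext x
  have h1 : HasFDerivAt (fun y : Rn n => ((‖y‖ ^ 2 : ℝ) : ℂ))
      (Complex.ofRealCLM ∘L (2 • innerSL ℝ x)) x :=
    Complex.ofRealCLM.hasFDerivAt.comp x (hasStrictFDerivAt_norm_sq x).hasFDerivAt
  have h2 : HasFDerivAt (fun y : Rn n => ((inner ℝ y ξ : ℝ) : ℂ))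
      (Complex.ofRealCLM ∘L (innerSL ℝ ξ)) x := by
    have := (Complex.ofRealCLM ∘L (innerSL ℝ ξ)).hasFDerivAt (x := x)
    refine this.congr_of_eventuallyEq (Eventually.of_forall fun y => ?_)
    simp [real_inner_comm]
  have h3 := (((h1.const_mul (-1 / 2 : ℂ)).fun_add (h2.const_mul (2 * z))).sub_const
    (z ^ 2 * ((‖ξ‖ ^ 2 : ℝ) : ℂ))).cexp
  have e : (coherentState ξ z : Rn n → ℂ) = fun y => Complex.exp (
      (-1 / 2 : ℂ) * ((‖y‖ ^ 2 : ℝ) : ℂ) +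
      2 * z * ((inner ℝ y ξ : ℝ) : ℂ) - z ^ 2 * ((‖ξ‖ ^ 2 : ℝ) : ℂ)) := by
    funext y
    rw [coherentState_apply, coherentExponent]
    congr 1
    ring
  rw [sub_apply, smul_apply, mulInner_apply, lineDerivOp_apply_fderiv, e, HasFDerivAt.fderiv h3]
  simp [real_inner_comm]
  ring

/-- The right-hand side is (n + 2z∂_z) applied to the coherent state: H becomes the Euler operator
in the parameter z, which is why the evolution will be a rotation. -/
theorem hermiteSchwartz_coherentState {n : ℕ} (ξ : Rn n) (z : ℂ) :
    hermiteSchwartz n (coherentState ξ z) =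
      ((n : ℂ) - 4 * z ^ 2 * ((‖ξ‖ ^ 2 : ℝ) : ℂ)) • coherentState ξ z +
        (4 * z) • mulInner ξ (coherentState ξ z) := by
  set b := EuclideanSpace.basisFun (Fin n) ℝ
  have key (v : Rn n) (x : Rn n) : (∂_{v} (∂_{v} (coherentState ξ z))) x =
      ((2 * z * ((inner ℝ v ξ : ℝ) : ℂ)) ^ 2 - 4 * z * ((inner ℝ v ξ * inner ℝ v x : ℝ) : ℂ)
        + ((inner ℝ v x ^ 2 : ℝ) : ℂ) - ((inner ℝ v v : ℝ) : ℂ)) * coherentState ξ z x := by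
    rw [lineDerivOp_coherentState, sub_eq_add_neg, LineDeriv.lineDerivOp_add,
      LineDeriv.lineDerivOp_smul, LineDeriv.lineDerivOp_neg,
      lineDerivOp_mulInner, lineDerivOp_coherentState]
    simp only [sub_apply, add_apply, neg_apply, smul_apply, smul_eq_mul, Complex.real_smul, map_sub,
      map_smul, mulInner_apply, real_inner_comm x v]
    push_cast
    ring
  have s1 : ∑ i, (inner ℝ (b i) ξ : ℝ) ^ 2 = ‖ξ‖ ^ 2 := by
    rw [← real_inner_self_eq_norm_sq, ← b.sum_inner_mul_inner ξ ξ]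
    exact Finset.sum_congr rfl fun i _ => by rw [real_inner_comm (b i) ξ]; ring
  have s2 (x : Rn n) : ∑ i, (inner ℝ (b i) ξ * inner ℝ (b i) x : ℝ) = inner ℝ x ξ := by
    rw [← b.sum_inner_mul_inner x ξ]
    exact Finset.sum_congr rfl fun i _ => by rw [real_inner_comm (b i) x]; ring
  have s3 (x : Rn n) : ∑ i, (inner ℝ (b i) x : ℝ) ^ 2 = ‖x‖ ^ 2 := by
    rw [← real_inner_self_eq_norm_sq, ← b.sum_inner_mul_inner x x]
    exact Finset.sum_congr rfl fun i _ => by rw [real_inner_comm (b i) x]; ring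
  have s4 : ∑ i, (inner ℝ (b i) (b i) : ℝ) = n := by
    simp
  ext x
  rw [hermiteSchwartz_apply, SchwartzMap.laplacian_eq_sum b, sum_apply]
  simp only [key]
  rw [← Finset.sum_mul, Finset.sum_sub_distrib, Finset.sum_add_distrib, Finset.sum_sub_distrib,
    ← Finset.mul_sum, ← Complex.ofReal_sum, ← Complex.ofReal_sum, ← Complex.ofReal_sum, s2, s3, s4]
  have s5 : ∑ i, (2 * z * ((inner ℝ (b i) ξ : ℝ) : ℂ)) ^ 2 =
      4 * z ^ 2 * ((‖ξ‖ ^ 2 : ℝ) : ℂ) := by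
    rw [← s1]
    push_cast
    rw [Finset.mul_sum]
    exact Finset.sum_congr rfl fun i _ => by ring
  rw [s5]
  simp only [add_apply, smul_apply, smul_eq_mul, mulInner_apply]
  push_cast
  ring

theorem coherentState_zero_mem_hermiteSpan {n : ℕ} (ξ : Rn n) :
    coherentState ξ 0 ∈ hermiteSpan n := by
  refine Submodule.subset_span ⟨n, ?_⟩
  rw [hermiteSchwartz_coherentState]
  simp

/-! ### The Bargmann transform and completeness of the eigenfunctions -/

theorem toDistrib_apply {n : ℕ} (g : L2 n) (φ : 𝓢(Rn n, ℂ)) :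
    toDistrib n g φ = ∫ x, φ x * g x :=
  Lp.toTemperedDistribution_apply g φ

/-- Half of the Gaussian absorbs the linear exponent; the other half is in L², so Cauchy–Schwarz
applies. This is the dominating function for exchanging limits and integrals below. -/
theorem integrable_norm_mul_exp {n : ℕ} (g : L2 n) (c : ℝ) :
    Integrable fun x : Rn n => ‖g x‖ * Real.exp (c * ‖x‖ - ‖x‖ ^ 2 / 2) := by
  let q : Rn n → ℂ := fun x => (-1 / 4 : ℂ) * ((‖x‖ ^ 2 : ℝ) : ℂ)
  have hq : ∀ x, q x = ((-(‖x‖ ^ 2) / 4 : ℝ) : ℂ) := fun x => by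
    simp only [q]; push_cast; ring
  let ψ : 𝓢(Rn n, ℂ) := schwartzExp q
    ((Function.HasTemperateGrowth.const _).mul (hasTemperateGrowth_normSq n))
    ⟨1 / 4, by norm_num, 0, fun x => by rw [hq, Complex.ofReal_re]; linarith⟩
  have hψ (x : Rn n) : ‖ψ x‖ = Real.exp (-(‖x‖ ^ 2) / 4) := by
    change ‖Complex.exp (q x)‖ = _
    rw [Complex.norm_exp, hq, Complex.ofReal_re]
  have h1 : Integrable (fun x => g x * ψ x) :=
    MemLp.integrable_mul (p := 2) (q := 2) (Lp.memLp g) (ψ.memLp 2)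
  refine (h1.norm.const_mul (Real.exp (c ^ 2))).mono' ?_ (Eventually.of_forall fun x => ?_)
  · refine (Lp.aestronglyMeasurable g).norm.mul (Continuous.aestronglyMeasurable ?_)
    fun_prop
  · rw [norm_mul, norm_norm, Real.norm_eq_abs, Real.abs_exp, norm_mul, hψ, mul_left_comm,
      ← Real.exp_add]
    gcongr
    nlinarith [sq_nonneg (‖x‖ / 2 - c)]

theorem norm_coherentState_le {n : ℕ} (ξ : Rn n) {z : ℂ} {R : ℝ} (hz : ‖z‖ ≤ R) (x : Rn n) :
    ‖coherentState ξ z x‖ ≤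
      Real.exp (R ^ 2 * ‖ξ‖ ^ 2) * Real.exp (2 * R * ‖ξ‖ * ‖x‖ - ‖x‖ ^ 2 / 2) := by
  rw [coherentState_apply, Complex.norm_exp, ← Real.exp_add, coherentExponent_re]
  have h1 : z.re * inner ℝ x ξ ≤ R * (‖x‖ * ‖ξ‖) := by
    refine (le_abs_self _).trans ?_
    rw [abs_mul]
    gcongr
    · exact (norm_nonneg z).trans hz
    · exact (Complex.abs_re_le_norm z).trans hz
    · exact abs_real_inner_le_norm x ξ
  have h2 : -(z ^ 2).re ≤ R ^ 2 := by
    refine (neg_le_abs _).trans ((Complex.abs_re_le_norm _).trans ?_)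
    rw [norm_pow]
    gcongr
  have h3 := mul_le_mul_of_nonneg_right h2 (sq_nonneg ‖ξ‖)
  refine Real.exp_le_exp.2 ?_
  nlinarith

theorem hasDerivAt_coherentState_apply {n : ℕ} (ξ : Rn n) (z : ℂ) (x : Rn n) :
    HasDerivAt (fun w => coherentState ξ w x)
      (((2 : ℂ) • mulInner ξ (coherentState ξ z) -
        (2 * z * ((‖ξ‖ ^ 2 : ℝ) : ℂ)) • coherentState ξ z) x) z := by
  have h : HasDerivAt (fun w => coherentExponent ξ w x)
      (2 * ((inner ℝ x ξ : ℝ) : ℂ) - 2 * z * ((‖ξ‖ ^ 2 : ℝ) : ℂ)) z := by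
    have h1 := ((((hasDerivAt_id z).const_mul 2).mul_const ((inner ℝ x ξ : ℝ) : ℂ)).const_add
      (-((‖x‖ ^ 2 : ℝ) : ℂ) / 2)).fun_sub
      (((hasDerivAt_id z).fun_pow 2).mul_const ((‖ξ‖ ^ 2 : ℝ) : ℂ))
    refine h1.congr_deriv ?_
    simp
  refine h.cexp.congr_deriv ?_
  rw [sub_apply, smul_apply, smul_apply, mulInner_apply, coherentState_apply, smul_eq_mul,
    smul_eq_mul]
  ring

/-- Differentiability at every complex z makes the Bargmann transform of an arbitrary L² function
entire. -/
theorem hasDerivAt_toDistrib_coherentState {n : ℕ} (g : L2 n) (ξ : Rn n) (z : ℂ) :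
    HasDerivAt (fun w => toDistrib n g (coherentState ξ w))
      (toDistrib n g ((2 : ℂ) • mulInner ξ (coherentState ξ z) -
        (2 * z * ((‖ξ‖ ^ 2 : ℝ) : ℂ)) • coherentState ξ z)) z := by
  simp only [toDistrib_apply]
  set R := ‖z‖ + 1
  have hR : 0 ≤ R := by positivity
  have hmeas (φ : 𝓢(Rn n, ℂ)) : AEStronglyMeasurable (fun x => φ x * g x) volume :=
    φ.continuous.aestronglyMeasurable.mul (Lp.aestronglyMeasurable g)
  refine (hasDerivAt_integral_of_dominated_loc_of_deriv_le
    (F := fun w x => coherentState ξ w x * g x)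
    (F' := fun w x => ((2 : ℂ) • mulInner ξ (coherentState ξ w) -
        (2 * w * ((‖ξ‖ ^ 2 : ℝ) : ℂ)) • coherentState ξ w) x * g x)
    (bound := fun x => Real.exp (2 * R * ‖ξ‖ ^ 2 + R ^ 2 * ‖ξ‖ ^ 2) *
      (‖g x‖ * Real.exp ((2 * R * ‖ξ‖ + 2 * ‖ξ‖) * ‖x‖ - ‖x‖ ^ 2 / 2)))
    (Metric.ball_mem_nhds z one_pos) (Eventually.of_forall fun w => hmeas _)
    ?_ (hmeas _) (Eventually.of_forall fun x w hw => ?_)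
    ((integrable_norm_mul_exp g _).const_mul _)
    (Eventually.of_forall fun x w _ => (hasDerivAt_coherentState_apply ξ w x).mul_const _)).2
  · exact MemLp.integrable_mul (p := 2) (q := 2) ((coherentState ξ z).memLp 2) (Lp.memLp g)
  · have hwR : ‖w‖ ≤ R := by
      have h := norm_le_norm_add_norm_sub' w z
      rw [mem_ball_iff_norm] at hw
      simp only [R]
      linarith
    have h1 := norm_coherentState_le ξ hwR x
    have h2 : ‖2 * ((inner ℝ x ξ : ℝ) : ℂ) - 2 * w * ((‖ξ‖ ^ 2 : ℝ) : ℂ)‖ ≤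
        Real.exp (2 * ‖ξ‖ * ‖x‖ + 2 * R * ‖ξ‖ ^ 2) := by
      refine (norm_sub_le _ _).trans (le_trans ?_ ((le_add_of_nonneg_right zero_le_one).trans
        (Real.add_one_le_exp _)))
      have h3 : ‖((inner ℝ x ξ : ℝ) : ℂ)‖ ≤ ‖x‖ * ‖ξ‖ := by
        rw [Complex.norm_real]; exact abs_real_inner_le_norm x ξ
      have h4 : ‖2 * w * ((‖ξ‖ ^ 2 : ℝ) : ℂ)‖ ≤ 2 * R * ‖ξ‖ ^ 2 := by
        rw [norm_mul, norm_mul, Complex.norm_real, Complex.norm_ofNat, Real.norm_of_nonneg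
          (sq_nonneg _)]
        gcongr
      rw [norm_mul, Complex.norm_ofNat]
      linarith
    have e : ((2 : ℂ) • mulInner ξ (coherentState ξ w) -
        (2 * w * ((‖ξ‖ ^ 2 : ℝ) : ℂ)) • coherentState ξ w) x =
        (2 * ((inner ℝ x ξ : ℝ) : ℂ) - 2 * w * ((‖ξ‖ ^ 2 : ℝ) : ℂ)) * coherentState ξ w x := by
      rw [sub_apply, smul_apply, smul_apply, mulInner_apply, smul_eq_mul, smul_eq_mul]
      ring
    rw [e, norm_mul, norm_mul]
    calc _ ≤ Real.exp (2 * ‖ξ‖ * ‖x‖ + 2 * R * ‖ξ‖ ^ 2) * (Real.exp (R ^ 2 * ‖ξ‖ ^ 2) *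
          Real.exp (2 * R * ‖ξ‖ * ‖x‖ - ‖x‖ ^ 2 / 2)) * ‖g x‖ := by gcongr
      _ = _ := by
        rw [mul_left_comm _ ‖g x‖, ← Real.exp_add, ← Real.exp_add, ← Real.exp_add, mul_comm]
        congr 2
        ring

/-- An `L²` function orthogonal to all coherent states with imaginary parameter vanishes. -/
theorem eq_zero_of_toDistrib_coherentState_I {n : ℕ} (g : L2 n)
    (hg : ∀ ξ : Rn n, toDistrib n g (coherentState ξ Complex.I) = 0) : g = 0 := by
  set h : Rn n → ℂ := fun x => coherentState 0 0 x * g x with hh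
  have hint : Integrable h :=
    MemLp.integrable_mul (p := 2) (q := 2) ((coherentState 0 0).memLp 2) (Lp.memLp g)
  have hF : 𝓕 h = 0 := by
    funext w
    rw [Real.fourier_eq']
    -- At ξ = -πw and z = i the cross term is the Fourier kernel exp(-2πi⟪x, w⟫), and -z²|ξ|²
    -- contributes only the constant π²|w|².
    have h0 := hg (-Real.pi • w)
    rw [toDistrib_apply] at h0
    have e : ∀ x, coherentState (-Real.pi • w) Complex.I x * g x =
        Complex.exp (((Real.pi ^ 2 * ‖w‖ ^ 2 : ℝ) : ℂ)) *
          (Complex.exp (((-2 * Real.pi * inner ℝ x w : ℝ) : ℂ) * Complex.I) • h x) := by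
      intro x
      simp only [hh, smul_eq_mul, coherentState_apply, coherentExponent]
      rw [← mul_assoc, ← mul_assoc, ← Complex.exp_add, ← Complex.exp_add]
      congr 2
      rw [norm_smul, mul_pow, inner_smul_right]
      simp
      ring
    simp only [e] at h0
    rw [integral_const_mul] at h0
    exact (mul_eq_zero.1 h0).resolve_left (Complex.exp_ne_zero _)
  -- Moving the Fourier transform onto the test function avoids inverting it on `h`, which is only
  -- known to be integrable.
  have key : ∀ φ : 𝓢(Rn n, ℂ), ∫ x, h x * φ x = 0 := by
    intro φ
    have := VectorFourier.integral_fourierIntegral_smul_eq_flip (L := innerₗ (Rn n))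
      Real.continuous_fourierChar continuous_inner hint
      (SchwartzMap.integrable (μ := volume) (𝓕⁻ φ : 𝓢(Rn n, ℂ)))
    have e1 : VectorFourier.fourierIntegral Real.fourierChar volume (innerₗ (Rn n)) h = 𝓕 h := rfl
    have e2 : VectorFourier.fourierIntegral Real.fourierChar volume (innerₗ (Rn n)).flip
        (𝓕⁻ φ : 𝓢(Rn n, ℂ)) = φ := by
      rw [flip_innerₗ]
      have e3 : 𝓕 (𝓕⁻ φ : 𝓢(Rn n, ℂ)) = φ := FourierTransform.fourier_fourierInv_eq φ
      exact congrArg (fun ψ : 𝓢(Rn n, ℂ) => (ψ : Rn n → ℂ)) e3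
    rw [e1, e2, hF] at this
    simpa using this.symm
  have hz : ∀ᵐ x, h x = 0 := by
    refine ae_eq_zero_of_integral_contDiff_smul_eq_zero hint.locallyIntegrable
      fun ψ hψ hc => ?_
    have hc' : HasCompactSupport (Complex.ofRealCLM ∘ ψ) := hc.comp_left rfl
    have hd' : ContDiff ℝ ∞ (Complex.ofRealCLM ∘ ψ) := by fun_prop
    rw [← key (hc'.toSchwartzMap hd')]
    refine integral_congr_ae (Eventually.of_forall fun x => ?_)
    simp [mul_comm]
  rw [Lp.eq_zero_iff_ae_eq_zero]
  filter_upwards [hz] with x hx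
  exact (mul_eq_zero.1 hx).resolve_left (Complex.exp_ne_zero _)

theorem iterate_mulInner_apply {n : ℕ} (ξ : Rn n) (φ : 𝓢(Rn n, ℂ)) (m : ℕ) (x : Rn n) :
    ((mulInner ξ)^[m] φ) x = ((inner ℝ x ξ : ℝ) : ℂ) ^ m * φ x := by
  induction m with
  | zero => simp
  | succ m ih => rw [Function.iterate_succ_apply', mulInner_apply, ih]; ring

/-- Completeness of the Schwartz eigenfunctions of the Hermite operator. -/
theorem eq_zero_of_toDistrib_hermiteSpan {n : ℕ} (g : L2 n)
    (hg : ∀ φ ∈ hermiteSpan n, toDistrib n g φ = 0) : g = 0 := by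
  refine eq_zero_of_toDistrib_coherentState_I g fun ξ => ?_
  have hmem (m : ℕ) : (mulInner ξ)^[m] (coherentState ξ 0) ∈ hermiteSpan n := by
    induction m with
    | zero => exact coherentState_zero_mem_hermiteSpan ξ
    | succ m ih => rw [Function.iterate_succ_apply']; exact mulInner_mem_hermiteSpan ξ ih
  set A : ℂ := Complex.exp ((‖ξ‖ ^ 2 : ℝ) : ℂ)
  set a : Rn n → ℂ := fun x => 2 * Complex.I * ((inner ℝ x ξ : ℝ) : ℂ)
  have ha (x : Rn n) : ‖a x‖ ≤ 2 * ‖ξ‖ * ‖x‖ := by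
    simp only [a, norm_mul, Complex.norm_ofNat, Complex.norm_I, Complex.norm_real]
    have := abs_real_inner_le_norm x ξ
    rw [Real.norm_eq_abs]
    linarith
  have hG0 (x : Rn n) : ‖coherentState ξ 0 x‖ = Real.exp (-‖x‖ ^ 2 / 2) := by
    rw [coherentState_apply, Complex.norm_exp, coherentExponent_re]; simp
  have hexp (x : Rn n) : HasSum (fun m : ℕ => (2 * ‖ξ‖ * ‖x‖) ^ m / m.factorial)
      (Real.exp (2 * ‖ξ‖ * ‖x‖)) := by
    rw [Real.exp_eq_exp_ℝ]
    exact NormedSpace.expSeries_div_hasSum_exp _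
  -- The state at z = i is e^{|ξ|²} exp(2i⟪x, ξ⟫) times the Gaussian. Expanding the exponential,
  -- each term is a multiple of an element of `hermiteSpan`; the sum of absolute values is still
  -- integrable against `g`.
  have hs := hasSum_integral_of_dominated_convergence (μ := (volume : Measure (Rn n)))
    (F := fun (m : ℕ) x => A * ((a x) ^ m / m.factorial * coherentState ξ 0 x * g x))
    (f := fun x => coherentState ξ Complex.I x * g x)
    (fun m x => ‖A‖ * ((2 * ‖ξ‖ * ‖x‖) ^ m / m.factorial * Real.exp (-‖x‖ ^ 2 / 2) * ‖g x‖))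
    (fun m => by
      refine AEStronglyMeasurable.const_mul (AEStronglyMeasurable.mul
        (Continuous.aestronglyMeasurable ?_) (Lp.aestronglyMeasurable g)) _
      have := (coherentState ξ 0).continuous
      simp only [a]
      fun_prop)
    (fun m => Eventually.of_forall fun x => by
      rw [norm_mul, norm_mul, norm_mul, hG0, norm_div, norm_pow, Complex.norm_natCast]
      gcongr
      exact ha x)
    (Eventually.of_forall fun x => (((hexp x).summable.mul_right _).mul_right _).mul_left _)
    (by
      have e : ∀ x : Rn n, ∑' m : ℕ, ‖A‖ * ((2 * ‖ξ‖ * ‖x‖) ^ m / m.factorial *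
          Real.exp (-‖x‖ ^ 2 / 2) * ‖g x‖) =
          ‖A‖ * (‖g x‖ * Real.exp (2 * ‖ξ‖ * ‖x‖ - ‖x‖ ^ 2 / 2)) := by
        intro x
        rw [((((hexp x).mul_right (Real.exp (-‖x‖ ^ 2 / 2))).mul_right ‖g x‖).mul_left ‖A‖).tsum_eq,
          ← Real.exp_add, mul_comm ‖g x‖]
        congr 3
        ring
      simp only [e]
      exact (integrable_norm_mul_exp g _).const_mul _)
    (Eventually.of_forall fun x => by
      have h1 : HasSum (fun m : ℕ => (a x) ^ m / m.factorial) (Complex.exp (a x)) := by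
        rw [Complex.exp_eq_exp_ℂ]
        exact NormedSpace.expSeries_div_hasSum_exp _
      have h2 := ((h1.mul_right (coherentState ξ 0 x)).mul_right (g x)).mul_left A
      convert! h2 using 1
      rw [← mul_assoc A, ← mul_assoc A]
      simp only [A, a, coherentState_apply, coherentExponent]
      rw [← Complex.exp_add, ← Complex.exp_add]
      congr 2
      simp
      ring)
  rw [toDistrib_apply, ← hs.tsum_eq]
  have hterm (m : ℕ) : ∫ x, A * ((a x) ^ m / m.factorial * coherentState ξ 0 x * g x) = 0 := by
    have e : ∀ x, A * ((a x) ^ m / m.factorial * coherentState ξ 0 x * g x) =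
        (A * (2 * Complex.I) ^ m / m.factorial) *
          (((mulInner ξ)^[m] (coherentState ξ 0)) x * g x) := by
      intro x
      rw [iterate_mulInner_apply]
      simp only [a, mul_pow]
      ring
    simp only [e]
    rw [integral_const_mul, ← toDistrib_apply, hg _ (hmem m), mul_zero]
  simp only [hterm, tsum_zero]

/-! ### Diagonal contractions on an orthogonal family -/

section PhaseOperator

variable {ι E : Type*} [NormedAddCommGroup E] [InnerProductSpace ℂ E]
  {V : ι → Submodule ℂ E} [∀ i, CompleteSpace (V i)]

/-- Bessel's inequality: the partial sum S of projections satisfies ⟪S, f⟫ = ‖S‖², so Cauchy–Schwarz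
gives ‖S‖ ≤ ‖f‖. -/
theorem sum_norm_sq_starProjection_le
    (hV : OrthogonalFamily ℂ (fun i => V i) fun i => (V i).subtypeₗᵢ) (f : E) (s : Finset ι) :
    ∑ i ∈ s, ‖(V i).starProjection f‖ ^ 2 ≤ ‖f‖ ^ 2 := by
  set S := ∑ i ∈ s, (V i).starProjection f
  have h1 : ‖S‖ ^ 2 = ∑ i ∈ s, ‖(V i).starProjection f‖ ^ 2 :=
    hV.norm_sum (fun i => (V i).orthogonalProjectionOnto f) s
  have h2 : inner ℂ S f = ((‖S‖ ^ 2 : ℝ) : ℂ) := by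
    rw [h1, sum_inner]
    push_cast
    refine Finset.sum_congr rfl fun i _ => ?_
    have h3 : inner ℂ ((V i).starProjection f) (f - (V i).starProjection f) = 0 :=
      (V i).sub_starProjection_mem_orthogonal f _ ((V i).starProjection_apply_mem f)
    rw [inner_sub_right, sub_eq_zero] at h3
    rw [h3, inner_self_eq_norm_sq_to_K]
    rfl
  have h3 : ‖S‖ ^ 2 ≤ ‖S‖ * ‖f‖ := by
    have := norm_inner_le_norm (𝕜 := ℂ) S f
    rwa [h2, Complex.norm_real, Real.norm_of_nonneg (sq_nonneg _)] at this
  rw [← h1]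
  have h4 : ‖S‖ ≤ ‖f‖ := by
    by_contra! h
    nlinarith [norm_nonneg f]
  gcongr

variable [CompleteSpace E]

theorem summable_phase
    (hV : OrthogonalFamily ℂ (fun i => V i) fun i => (V i).subtypeₗᵢ) {c : ι → ℂ}
    (hc : ∀ i, ‖c i‖ ≤ 1) (f : E) : Summable fun i => c i • (V i).starProjection f := by
  refine (hV.summable_iff_norm_sq_summable fun i => c i • (V i).orthogonalProjectionOnto f).2 ?_
  refine summable_of_sum_le (c := ‖f‖ ^ 2) (fun i => sq_nonneg _) fun s => ?_
  refine (Finset.sum_le_sum fun i _ => ?_).trans (sum_norm_sq_starProjection_le hV f s)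
  rw [norm_smul]
  gcongr
  exact mul_le_of_le_one_left (norm_nonneg _) (hc i)

theorem norm_tsum_phase_le
    (hV : OrthogonalFamily ℂ (fun i => V i) fun i => (V i).subtypeₗᵢ) {c : ι → ℂ}
    (hc : ∀ i, ‖c i‖ ≤ 1) (f : E) : ‖∑' i, c i • (V i).starProjection f‖ ≤ ‖f‖ := by
  refine le_of_tendsto (summable_phase hV hc f).hasSum.norm (Eventually.of_forall fun s => ?_)
  have h1 : ‖∑ i ∈ s, c i • (V i).starProjection f‖ ^ 2 =
      ∑ i ∈ s, ‖c i • (V i).orthogonalProjectionOnto f‖ ^ 2 :=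
    hV.norm_sum (fun i => c i • (V i).orthogonalProjectionOnto f) s
  refine le_of_sq_le_sq ?_ (norm_nonneg f)
  rw [h1]
  refine (Finset.sum_le_sum fun i _ => ?_).trans (sum_norm_sq_starProjection_le hV f s)
  rw [norm_smul]
  gcongr
  exact mul_le_of_le_one_left (norm_nonneg _) (hc i)

/-- The operator acting on the summand `V i` of an orthogonal family as multiplication by `c i`. -/
def phaseOp (hV : OrthogonalFamily ℂ (fun i => V i) fun i => (V i).subtypeₗᵢ) {c : ι → ℂ}
    (hc : ∀ i, ‖c i‖ ≤ 1) : E →L[ℂ] E :=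
  LinearMap.mkContinuous
    { toFun := fun f => ∑' i, c i • (V i).starProjection f
      map_add' := fun f g => by
        rw [← (summable_phase hV hc f).tsum_add (summable_phase hV hc g)]
        simp
      map_smul' := fun a f => by
        rw [RingHom.id_apply, ← (summable_phase hV hc f).tsum_const_smul]
        simp [smul_comm a] }
    1 fun f => by rw [one_mul]; exact norm_tsum_phase_le hV hc f

theorem phaseOp_apply (hV : OrthogonalFamily ℂ (fun i => V i) fun i => (V i).subtypeₗᵢ)
    {c : ι → ℂ} (hc : ∀ i, ‖c i‖ ≤ 1) (f : E) :
    phaseOp hV hc f = ∑' i, c i • (V i).starProjection f := rfl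

theorem norm_phaseOp_apply_le (hV : OrthogonalFamily ℂ (fun i => V i) fun i => (V i).subtypeₗᵢ)
    {c : ι → ℂ} (hc : ∀ i, ‖c i‖ ≤ 1) (f : E) : ‖phaseOp hV hc f‖ ≤ ‖f‖ :=
  norm_tsum_phase_le hV hc f

theorem phaseOp_apply_of_mem (hV : OrthogonalFamily ℂ (fun i => V i) fun i => (V i).subtypeₗᵢ)
    {c : ι → ℂ} (hc : ∀ i, ‖c i‖ ≤ 1) {i : ι} {f : E} (hf : f ∈ V i) :
    phaseOp hV hc f = c i • f := by
  rw [phaseOp_apply, tsum_eq_single i, (V i).starProjection_eq_self_iff.2 hf]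
  intro j hj
  have : (V j).starProjection f = 0 := by
    rw [Submodule.starProjection_apply_eq_zero_iff]
    intro g hg
    exact hV hj ⟨g, hg⟩ ⟨f, hf⟩
  rw [this, smul_zero]

end PhaseOperator

/-! ### The L² eigenspaces: orthogonality and density -/

/-- Complex conjugation of Schwartz functions. -/
def conjSchwartz {n : ℕ} (φ : 𝓢(Rn n, ℂ)) : 𝓢(Rn n, ℂ) :=
  SchwartzMap.postcompCLM (𝕜 := ℝ) (Complex.conjCLE : ℂ →L[ℝ] ℂ) φ

theorem conjSchwartz_apply {n : ℕ} (φ : 𝓢(Rn n, ℂ)) (x : Rn n) :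
    conjSchwartz φ x = starRingEnd ℂ (φ x) := by
  rw [conjSchwartz, SchwartzMap.postcompCLM_apply]
  rfl

theorem lineDerivOp_conjSchwartz {n : ℕ} (v : Rn n) (φ : 𝓢(Rn n, ℂ)) :
    ∂_{v} (conjSchwartz φ) = conjSchwartz (∂_{v} φ) := by
  ext x
  have h := (Complex.conjCLE : ℂ →L[ℝ] ℂ).hasFDerivAt.comp x (φ.hasFDerivAt x)
  have e : (conjSchwartz φ : Rn n → ℂ) = (Complex.conjCLE : ℂ →L[ℝ] ℂ) ∘ φ :=
    funext fun y => conjSchwartz_apply φ y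
  rw [conjSchwartz_apply, lineDerivOp_apply_fderiv, lineDerivOp_apply_fderiv, e, h.fderiv]
  rfl

theorem hermiteSchwartz_conjSchwartz {n : ℕ} (φ : 𝓢(Rn n, ℂ)) :
    hermiteSchwartz n (conjSchwartz φ) = conjSchwartz (hermiteSchwartz n φ) := by
  ext x
  rw [conjSchwartz_apply, hermiteSchwartz_apply, hermiteSchwartz_apply, conjSchwartz_apply,
    SchwartzMap.laplacian_eq_sum (EuclideanSpace.basisFun (Fin n) ℝ),
    SchwartzMap.laplacian_eq_sum (EuclideanSpace.basisFun (Fin n) ℝ), sum_apply, sum_apply]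
  simp only [lineDerivOp_conjSchwartz, conjSchwartz_apply, map_add, map_neg, map_sum, map_mul,
    Complex.conj_ofReal]

/-- The pairing of `L²` functions with a fixed Schwartz function. -/
def pairing {n : ℕ} (φ : 𝓢(Rn n, ℂ)) : L2 n →L[ℂ] ℂ :=
  (PointwiseConvergenceCLM.evalCLM (RingHom.id ℂ) ℂ φ) ∘L toDistrib n

theorem pairing_apply {n : ℕ} (φ : 𝓢(Rn n, ℂ)) (g : L2 n) : pairing φ g = toDistrib n g φ := rfl

theorem mem_hermiteEigenspace_iff {n : ℕ} {μ : ℝ} {g : L2 n} :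
    g ∈ hermiteEigenspace n μ ↔
      ∀ φ, toDistrib n g (hermiteSchwartz n φ) = (μ : ℂ) * toDistrib n g φ := by
  constructor
  · intro hg φ
    have h : hermiteOp n (toDistrib n g) = (μ : ℂ) • toDistrib n g := hg
    rw [← hermiteOp_eq, h]
    rfl
  · intro h
    change hermiteOp n (toDistrib n g) = (μ : ℂ) • toDistrib n g
    ext φ
    rw [hermiteOp_eq]
    exact h φ

/-- The distributional pairing is bilinear while the inner product is sesquilinear. Conjugation
translates between them, harmlessly because H has real coefficients. -/
theorem toDistrib_star {n : ℕ} (g : L2 n) (φ : 𝓢(Rn n, ℂ)) :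
    toDistrib n (star g) φ = starRingEnd ℂ (toDistrib n g (conjSchwartz φ)) := by
  rw [toDistrib_apply, toDistrib_apply, ← integral_conj]
  refine integral_congr_ae ?_
  filter_upwards [Lp.coeFn_star g] with x hx
  rw [hx, map_mul, conjSchwartz_apply, Complex.conj_conj]
  rfl

theorem star_mem_hermiteEigenspace {n : ℕ} {μ : ℝ} {g : L2 n} (hg : g ∈ hermiteEigenspace n μ) :
    star g ∈ hermiteEigenspace n μ := by
  rw [mem_hermiteEigenspace_iff] at hg ⊢
  intro φ
  rw [toDistrib_star, toDistrib_star, ← hermiteSchwartz_conjSchwartz, hg, map_mul,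
    Complex.conj_ofReal]

theorem inner_toLp {n : ℕ} (g : L2 n) (φ : 𝓢(Rn n, ℂ)) :
    inner ℂ g (φ.toLp 2 volume) = toDistrib n (star g) φ := by
  rw [toDistrib_apply, L2.inner_def]
  refine integral_congr_ae ?_
  filter_upwards [Lp.coeFn_star g, φ.coeFn_toLp 2 volume] with x hx h2
  rw [hx, h2]
  rfl

theorem toLp_mem_hermiteEigenspace {n : ℕ} {μ : ℝ} {φ : 𝓢(Rn n, ℂ)}
    (hφ : hermiteSchwartz n φ = (μ : ℂ) • φ) : φ.toLp 2 volume ∈ hermiteEigenspace n μ := by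
  have hT (ψ : 𝓢(Rn n, ℂ)) : toDistrib n (φ.toLp 2 volume) ψ = ∫ x, ψ x * φ x := by
    rw [toDistrib_apply]
    refine integral_congr_ae ?_
    filter_upwards [φ.coeFn_toLp 2 volume] with x hx
    rw [hx]
  have hint (ψ χ : 𝓢(Rn n, ℂ)) : Integrable fun x => ψ x * χ x :=
    MemLp.integrable_mul (p := 2) (q := 2) (ψ.memLp 2) (χ.memLp 2)
  set Q := SchwartzMap.smulLeftCLM (E := Rn n) ℂ (fun x : Rn n => ((‖x‖ ^ 2 : ℝ) : ℂ))
  rw [mem_hermiteEigenspace_iff]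
  intro ψ
  rw [hermiteSchwartz_eq, map_add, map_neg, hT, hT, hT,
    ← SchwartzMap.integral_mul_laplacian_right_eq_left]
  have h2 : ∫ x, Q ψ x * φ x = ∫ x, ψ x * Q φ x := by
    refine integral_congr_ae (Eventually.of_forall fun x => ?_)
    simp only [Q, SchwartzMap.smulLeftCLM_apply_apply (hasTemperateGrowth_normSq n), smul_eq_mul]
    ring
  have h4 : Integrable fun x => -(ψ x * (Δ φ) x) := (hint ψ (Δ φ)).neg
  rw [h2, ← integral_neg, ← integral_add h4 (hint _ _), ← integral_const_mul]
  refine integral_congr_ae (Eventually.of_forall fun x => ?_)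
  have h3 := congrArg (fun χ : 𝓢(Rn n, ℂ) => χ x) hφ
  simp only [hermiteSchwartz_eq, add_apply, neg_apply, smul_apply, smul_eq_mul] at h3
  linear_combination ψ x * h3

theorem toDistrib_eq_zero_of_ne {n : ℕ} {μ ν : ℝ} (h : μ ≠ ν) {g : L2 n}
    (hg : g ∈ hermiteEigenspace n μ) {φ : 𝓢(Rn n, ℂ)}
    (hφ : hermiteSchwartz n φ = (ν : ℂ) • φ) : toDistrib n g φ = 0 := by
  have h1 := mem_hermiteEigenspace_iff.1 hg φ
  rw [hφ, map_smul, smul_eq_mul, ← sub_eq_zero, ← sub_mul] at h1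
  refine (mul_eq_zero.1 h1).resolve_left ?_
  exact sub_ne_zero.2 (mod_cast h.symm)

theorem eq_zero_of_inner_toLp {n : ℕ} (g : L2 n)
    (h : ∀ (ν : ℝ) (φ : 𝓢(Rn n, ℂ)), hermiteSchwartz n φ = (ν : ℂ) • φ →
      inner ℂ g (φ.toLp 2 volume) = 0) : g = 0 := by
  suffices hs : star g = 0 by
    rw [Lp.eq_zero_iff_ae_eq_zero] at hs ⊢
    filter_upwards [hs, Lp.coeFn_star g] with x h1 h2
    rw [h2] at h1
    exact star_eq_zero.1 h1
  refine eq_zero_of_toDistrib_hermiteSpan _ fun φ hφ => ?_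
  induction hφ using Submodule.span_induction with
  | zero => simp
  | add x y _ _ hx hy => rw [map_add, hx, hy, add_zero]
  | smul a x _ hx => rw [map_smul, hx, smul_zero]
  | mem φ hφ =>
    obtain ⟨ν, hν⟩ := hφ
    rw [← inner_toLp]
    exact h ν φ hν

/-- Membership in an eigenspace is distributional, so H cannot simply be moved across the inner
product of two L² functions. Instead `g` is shown to lie in the closed span K of the Schwartz
eigenfunctions for μ, and every element of K is orthogonal to `h` because the equation for `h` can
be tested on Schwartz functions. -/
theorem inner_eq_zero_of_mem_hermiteEigenspace {n : ℕ} {μ ν : ℝ} (hμν : μ ≠ ν) {g h : L2 n}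
    (hg : g ∈ hermiteEigenspace n μ) (hh : h ∈ hermiteEigenspace n ν) : inner ℂ h g = 0 := by
  let W : Submodule ℂ (L2 n) :=
    Submodule.span ℂ {k | ∃ φ, hermiteSchwartz n φ = (μ : ℂ) • φ ∧ k = φ.toLp 2 volume}
  let K := W.topologicalClosure
  have hWE : W ≤ hermiteEigenspace n μ := by
    refine Submodule.span_le.2 ?_
    rintro _ ⟨φ, hφ, rfl⟩
    exact toLp_mem_hermiteEigenspace hφ
  have hKE : K ≤ hermiteEigenspace n μ :=
    W.topologicalClosure_minimal hWE (isClosed_hermiteEigenspace n μ)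
  have hKh : ∀ k ∈ K, inner ℂ h k = 0 := by
    have hle : W ≤ (innerSL ℂ h).ker := by
      refine Submodule.span_le.2 ?_
      rintro _ ⟨φ, hφ, rfl⟩
      change inner ℂ h _ = 0
      rw [inner_toLp]
      exact toDistrib_eq_zero_of_ne hμν.symm (star_mem_hermiteEigenspace hh) hφ
    exact W.topologicalClosure_minimal hle (innerSL ℂ h).isClosed_ker
  have : CompleteSpace K := W.isClosed_topologicalClosure.completeSpace_coe
  -- The residual is orthogonal to the Schwartz eigenfunctions for μ by projection, and to those for
  -- other eigenvalues because it still lies in the μ-eigenspace; totality makes it zero.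
  have hgK : g - K.starProjection g = 0 := by
    refine eq_zero_of_inner_toLp _ fun ν' φ hφ => ?_
    by_cases hν : μ = ν'
    · subst hν
      refine Submodule.inner_left_of_mem_orthogonal (K := K) ?_
        (K.sub_starProjection_mem_orthogonal g)
      exact W.le_topologicalClosure (Submodule.subset_span ⟨φ, hφ, rfl⟩)
    · rw [inner_toLp]
      refine toDistrib_eq_zero_of_ne hν (star_mem_hermiteEigenspace ?_) hφ
      exact sub_mem hg (hKE (K.starProjection_apply_mem g))
  rw [sub_eq_zero.1 hgK]
  exact hKh _ (K.starProjection_apply_mem g)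

theorem orthogonalFamily_hermiteEigenspace (n : ℕ) :
    OrthogonalFamily ℂ (fun μ => hermiteEigenspace n μ)
      fun μ => (hermiteEigenspace n μ).subtypeₗᵢ :=
  fun _ _ h v w => inner_eq_zero_of_mem_hermiteEigenspace h.symm w.2 v.2

theorem dense_span_hermiteEigenspace (n : ℕ) :
    Dense (Submodule.span ℂ (⋃ μ, (hermiteEigenspace n μ : Set (L2 n))) : Set (L2 n)) := by
  rw [Submodule.dense_iff_topologicalClosure_eq_top,
    Submodule.topologicalClosure_eq_top_iff, Submodule.eq_bot_iff]
  intro g hg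
  refine eq_zero_of_inner_toLp g fun ν φ hφ => ?_
  refine Submodule.inner_left_of_mem_orthogonal ?_ hg
  exact Submodule.subset_span (Set.mem_iUnion.2 ⟨ν, toLp_mem_hermiteEigenspace hφ⟩)

/-! ### The propagator and the Cauchy problem -/

theorem norm_exp_phase_le (s μ : ℝ) : ‖Complex.exp (-(Complex.I * s * μ))‖ ≤ 1 := by
  rw [Complex.norm_exp]
  simp

/-- The operator `e^{-isH}` as a continuous linear map. -/
def hermitePropagator (n : ℕ) (s : ℝ) : L2 n →L[ℂ] L2 n :=
  phaseOp (orthogonalFamily_hermiteEigenspace n) (norm_exp_phase_le s)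

theorem hermitePropagator_apply {n : ℕ} (s : ℝ) (f : L2 n) :
    hermitePropagator n s f = hermiteSchrodinger n s f := rfl

theorem norm_hermitePropagator_apply_le {n : ℕ} (s : ℝ) (f : L2 n) :
    ‖hermitePropagator n s f‖ ≤ ‖f‖ := norm_phaseOp_apply_le _ _ f

theorem hermitePropagator_of_mem {n : ℕ} {μ : ℝ} (s : ℝ) {f : L2 n}
    (hf : f ∈ hermiteEigenspace n μ) :
    hermitePropagator n s f = Complex.exp (-(Complex.I * s * μ)) • f :=
  phaseOp_apply_of_mem _ _ hf

theorem hermitePropagator_zero (n : ℕ) : hermitePropagator n 0 = ContinuousLinearMap.id ℂ _ := by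
  refine ContinuousLinearMap.ext_on (dense_span_hermiteEigenspace n) fun f hf => ?_
  obtain ⟨μ, hμ⟩ := Set.mem_iUnion.1 hf
  rw [hermitePropagator_of_mem 0 hμ]
  simp

theorem hasDerivAt_exp_phase (μ s : ℝ) :
    HasDerivAt (fun t : ℝ => Complex.exp (-(Complex.I * t * μ)))
      (-Complex.I * μ * Complex.exp (-(Complex.I * s * μ))) s := by
  have h := ((Complex.ofRealCLM.hasDerivAt (x := s)).const_mul (-(Complex.I * μ))).cexp
  have e : ∀ t : ℝ, -(Complex.I * t * μ) = -(Complex.I * μ) * Complex.ofRealCLM t := fun t => by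
    simp only [Complex.ofRealCLM_apply]; ring
  simp only [e]
  refine h.congr_deriv ?_
  simp
  ring

theorem continuous_hermitePropagator_of_mem_span {n : ℕ} {f : L2 n}
    (hf : f ∈ Submodule.span ℂ (⋃ μ, (hermiteEigenspace n μ : Set (L2 n)))) :
    Continuous fun s => hermitePropagator n s f := by
  induction hf using Submodule.span_induction with
  | zero => simpa using continuous_const
  | add x y _ _ hx hy =>
    simp only [map_add]
    exact hx.add hy
  | smul a x _ hx =>
    simp only [map_smul]
    exact hx.const_smul a
  | mem x h =>
    obtain ⟨μ, hμ⟩ := Set.mem_iUnion.1 h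
    simp only [hermitePropagator_of_mem _ hμ]
    fun_prop

theorem hasDerivAt_pairing_of_mem_span {n : ℕ} {f : L2 n}
    (hf : f ∈ Submodule.span ℂ (⋃ μ, (hermiteEigenspace n μ : Set (L2 n))))
    (φ : 𝓢(Rn n, ℂ)) (s : ℝ) :
    HasDerivAt (fun t => pairing φ (hermitePropagator n t f))
      (-Complex.I * pairing (hermiteSchwartz n φ) (hermitePropagator n s f)) s := by
  induction hf using Submodule.span_induction with
  | zero => simpa using hasDerivAt_const s (0 : ℂ)
  | add x y _ _ hx hy =>
    simp only [map_add, mul_add]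
    exact hx.fun_add hy
  | smul a x _ hx =>
    simp only [map_smul, smul_eq_mul]
    exact (hx.const_mul a).congr_deriv (by ring)
  | mem x h =>
    obtain ⟨μ, hμ⟩ := Set.mem_iUnion.1 h
    simp only [hermitePropagator_of_mem _ hμ, map_smul, smul_eq_mul]
    have h1 : pairing (hermiteSchwartz n φ) x = μ * pairing φ x :=
      mem_hermiteEigenspace_iff.1 hμ φ
    rw [h1]
    exact ((hasDerivAt_exp_phase μ s).mul_const _).congr_deriv (by ring)

theorem tendstoUniformly_hermitePropagator {n : ℕ} (f : L2 n) (D : Set (L2 n)) :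
    TendstoUniformly (fun d s => hermitePropagator n s d) (fun s => hermitePropagator n s f)
      (𝓝[D] f) := by
  rw [Metric.tendstoUniformly_iff]
  intro ε hε
  filter_upwards [mem_nhdsWithin_of_mem_nhds (Metric.ball_mem_nhds f hε)] with d hd s
  rw [dist_eq_norm, ← map_sub]
  refine (norm_hermitePropagator_apply_le s _).trans_lt ?_
  rwa [mem_ball_iff_norm'] at hd

/-- Contractivity makes the approximation of `f` by finite sums of eigenvectors uniform in time, so
both continuity and the derivative of each pairing survive the limit. -/
theorem isSchrodingerSolution_hermiteSchrodinger {n : ℕ} (f : L2 n) :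
    IsSchrodingerSolution f fun s => hermiteSchrodinger n s f := by
  set D : Submodule ℂ (L2 n) := Submodule.span ℂ (⋃ μ, (hermiteEigenspace n μ : Set (L2 n)))
  have hne : (𝓝[(D : Set (L2 n))] f).NeBot :=
    mem_closure_iff_nhdsWithin_neBot.1 (dense_span_hermiteEigenspace n f)
  have hu := tendstoUniformly_hermitePropagator f D
  refine ⟨?_, fun φ s => ?_, ?_⟩
  · exact hu.continuous (eventually_nhdsWithin_of_forall fun d hd =>
      continuous_hermitePropagator_of_mem_span hd).frequently
  · rw [hermiteOp_eq]
    refine hasDerivAt_of_tendstoUniformly (l := 𝓝[(D : Set (L2 n))] f)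
      (f := fun d t => pairing φ (hermitePropagator n t d))
      (f' := fun d t => -Complex.I * pairing (hermiteSchwartz n φ) (hermitePropagator n t d))
      (g := fun t => pairing φ (hermitePropagator n t f))
      (g' := fun t => -Complex.I * pairing (hermiteSchwartz n φ) (hermitePropagator n t f))
      ?_ (eventually_nhdsWithin_of_forall fun d hd t => hasDerivAt_pairing_of_mem_span hd φ t)
      (fun t => ?_) s
    · exact (-Complex.I • pairing (hermiteSchwartz n φ)).uniformContinuous.comp_tendstoUniformly hu
    · exact ((pairing φ).continuous.tendsto _).comp (hu.tendsto_at t)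
  · change hermitePropagator n 0 f = f
    rw [hermitePropagator_zero]
    rfl

theorem toDistrib_eq_of_isSchrodingerSolution {n : ℕ} {f : L2 n} {v : ℝ → L2 n}
    (hv : IsSchrodingerSolution f v) {μ : ℝ} {φ : 𝓢(Rn n, ℂ)}
    (hφ : hermiteSchwartz n φ = (μ : ℂ) • φ) (s : ℝ) :
    toDistrib n (v s) φ = Complex.exp (-(Complex.I * s * μ)) * toDistrib n f φ := by
  have h1 (t : ℝ) : HasDerivAt
      (fun t : ℝ => Complex.exp (-(Complex.I * t * (-μ : ℝ))) * toDistrib n (v t) φ) 0 t := by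
    refine ((hasDerivAt_exp_phase (-μ) t).mul (hv.equation φ t)).congr_deriv ?_
    rw [hermiteOp_eq, hφ, map_smul, smul_eq_mul]
    push_cast
    ring
  have h2 := is_const_of_deriv_eq_zero (fun t => (h1 t).differentiableAt)
    (fun t => (h1 t).deriv) s 0
  simp only [hv.initial, Complex.ofReal_zero, mul_zero, zero_mul, neg_zero, Complex.exp_zero,
    one_mul] at h2
  rw [← h2, ← mul_assoc, ← Complex.exp_add]
  simp

/-- Against a Schwartz eigenfunction the equation is a scalar linear ODE, so the initial value
determines the pairing; totality then determines the function. -/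
theorem IsSchrodingerSolution.eq {n : ℕ} {f : L2 n} {u v : ℝ → L2 n}
    (hu : IsSchrodingerSolution f u) (hv : IsSchrodingerSolution f v) (s : ℝ) : v s = u s := by
  rw [← sub_eq_zero]
  refine eq_zero_of_toDistrib_hermiteSpan _ fun φ hφ => ?_
  induction hφ using Submodule.span_induction with
  | zero => simp
  | add x y _ _ hx hy => rw [map_add, hx, hy, add_zero]
  | smul a x _ hx => rw [map_smul, hx, smul_zero]
  | mem φ hφ =>
    obtain ⟨μ, hμ⟩ := hφ
    rw [map_sub, sub_apply, toDistrib_eq_of_isSchrodingerSolution hu hμ,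
      toDistrib_eq_of_isSchrodingerSolution hv hμ, sub_self]

/-! ### Rotation of the Bargmann transform -/

/-- The evolution acts on the Bargmann transform by rotation of the complex variable. -/
theorem pairing_hermitePropagator_coherentState {n : ℕ} (f : L2 n) (ξ : Rn n) (z : ℂ) (s : ℝ) :
    pairing (coherentState ξ z) (hermitePropagator n s f) =
      Complex.exp (-(Complex.I * s * n)) *
        pairing (coherentState ξ (Complex.exp (-(2 * Complex.I * s)) * z)) f := by
  suffices h : (pairing (coherentState ξ z)) ∘L hermitePropagator n s =
      Complex.exp (-(Complex.I * s * n)) •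
        pairing (coherentState ξ (Complex.exp (-(2 * Complex.I * s)) * z)) from
    congrArg (fun T : L2 n →L[ℂ] ℂ => T f) h
  refine ContinuousLinearMap.ext_on (dense_span_hermiteEigenspace n) fun g hg => ?_
  obtain ⟨μ, hμ⟩ := Set.mem_iUnion.1 hg
  change pairing (coherentState ξ z) (hermitePropagator n s g) =
    Complex.exp (-(Complex.I * s * n)) *
      pairing (coherentState ξ (Complex.exp (-(2 * Complex.I * s)) * z)) g
  rw [hermitePropagator_of_mem s hμ, map_smul, smul_eq_mul]
  set K : ℂ → ℂ := fun w => toDistrib n g (coherentState ξ w)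
  -- For an eigenvector, its Bargmann transform solves the Euler equation 2wK' = (μ - n)K, a form of
  -- homogeneity. Hence e^{-it(n-μ)} K(e^{-2it}z) is constant in t.
  have hK (w : ℂ) : ∃ K', HasDerivAt K K' w ∧ 2 * w * K' = (μ - n) * K w := by
    refine ⟨_, hasDerivAt_toDistrib_coherentState g ξ w, ?_⟩
    have h1 := mem_hermiteEigenspace_iff.1 hμ (coherentState ξ w)
    rw [hermiteSchwartz_coherentState, map_add, map_smul, map_smul, smul_eq_mul, smul_eq_mul] at h1
    rw [map_sub, map_smul, map_smul, smul_eq_mul, smul_eq_mul]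
    linear_combination h1
  have h1 (t : ℝ) : HasDerivAt (fun t : ℝ => Complex.exp (-(Complex.I * t * (n - μ : ℝ))) *
      K (Complex.exp (-(Complex.I * t * (2 : ℝ))) * z)) 0 t := by
    obtain ⟨K', hK1, hK2⟩ := hK (Complex.exp (-(Complex.I * t * (2 : ℝ))) * z)
    have h2 := hK1.comp t ((hasDerivAt_exp_phase 2 t).mul_const z)
    refine ((hasDerivAt_exp_phase (n - μ) t).mul h2).congr_deriv ?_
    simp only [Function.comp_apply]
    push_cast at hK2 ⊢
    linear_combination -Complex.I * Complex.exp (-(Complex.I * t * (n - μ))) * hK2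
  have h2 := is_const_of_deriv_eq_zero (fun t => (h1 t).differentiableAt)
    (fun t => (h1 t).deriv) s 0
  have e0 : K (Complex.exp (-(Complex.I * (0 : ℝ) * (2 : ℝ))) * z) = K z := by simp
  have e1 : Complex.exp (-(Complex.I * s * (2 : ℝ))) = Complex.exp (-(2 * Complex.I * s)) := by
    push_cast; congr 1; ring
  have e2 : Complex.exp (-(Complex.I * s * n)) =
      Complex.exp (-(Complex.I * s * μ)) * Complex.exp (-(Complex.I * s * (n - μ : ℝ))) := by
    rw [← Complex.exp_add]; push_cast; congr 1; ring
  rw [e0, e1] at h2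
  have h3 : Complex.exp (-(Complex.I * (0 : ℝ) * (n - μ : ℝ))) = 1 := by simp
  rw [h3, one_mul] at h2
  rw [e2]
  change _ * K z = _ * K (Complex.exp (-(2 * Complex.I * s)) * z)
  linear_combination -Complex.exp (-(Complex.I * s * μ)) * h2

/-! ### Phragmén–Lindelöf for entire functions of order two -/

theorem norm_exp_mul_exp_two_mul (B K : ℝ) (w : ℂ) :
    ‖Complex.exp ((B - K * Complex.I) * Complex.exp (2 * w))‖ =
      Real.exp (Real.exp w.re ^ 2 * (B * Real.cos (2 * w.im) + K * Real.sin (2 * w.im))) := by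
  have e : 2 * w = ((2 * w.re : ℝ) : ℂ) + ((2 * w.im : ℝ) : ℂ) * Complex.I := by
    apply Complex.ext <;> simp
  rw [Complex.norm_exp, e, Complex.exp_add_mul_I, ← Complex.ofReal_exp, ← Complex.ofReal_cos,
    ← Complex.ofReal_sin, ← Real.exp_nat_mul]
  congr 1
  simp [-Complex.ofReal_exp, -Complex.ofReal_cos, -Complex.ofReal_sin]
  ring

/-- An entire function of order two and type at most `A` which decays on the positive half-line
like `exp (-B x²)` with `B > A` vanishes. -/
theorem eq_zero_of_gaussian_decay_on_ray {Ψ : ℂ → ℂ} (hΨ : Differentiable ℂ Ψ) {A B C : ℝ}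
    (hAB : A < B) (hA : ∀ z, ‖Ψ z‖ ≤ C * Real.exp (A * ‖z‖ ^ 2))
    (hB : ∀ x : ℝ, 0 < x → ‖Ψ x‖ ≤ C * Real.exp (-B * x ^ 2)) (z : ℂ) : Ψ z = 0 := by
  have hC : 0 ≤ C := by simpa using (norm_nonneg _).trans (hA 0)
  have sector : ∀ K : ℝ, 0 ≤ K → ∀ w : ℂ, w.im = Real.pi / 4 →
      ‖Ψ (Complex.exp w)‖ * Real.exp (Real.exp w.re ^ 2 * K) ≤ C := by
    intro K hK w hw
    -- At θ = π/2 the expression equals A - B < 0 whatever K is, so by continuity it stays negative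
    -- for some smaller θ, depending on K.
    obtain ⟨θ, hθ0, hθ1, hθ2⟩ : ∃ θ : ℝ, Real.pi / 4 < θ ∧ θ < Real.pi / 2 ∧
        A + (B * Real.cos (2 * θ) + K * Real.sin (2 * θ)) < 0 := by
      have hc : ContinuousAt (fun θ : ℝ => A + (B * Real.cos (2 * θ) + K * Real.sin (2 * θ)))
          (Real.pi / 2) := by fun_prop
      have h0 : A + (B * Real.cos (2 * (Real.pi / 2)) + K * Real.sin (2 * (Real.pi / 2))) < 0 := by
        rw [mul_div_cancel₀ _ (two_ne_zero), Real.cos_pi, Real.sin_pi]; linarith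
      have h1 := (hc.eventually_lt continuousAt_const h0).filter_mono
        (nhdsWithin_le_nhds (s := Set.Iio (Real.pi / 2)))
      have h2 : ∀ᶠ θ in 𝓝[<] (Real.pi / 2), θ ∈ Set.Ioo (Real.pi / 4) (Real.pi / 2) :=
        Ioo_mem_nhdsLT (by linarith [Real.pi_pos])
      obtain ⟨θ, h3, h4⟩ := (h1.and h2).exists
      exact ⟨θ, h4.1, h4.2, h3⟩
    -- In logarithmic coordinates the sector is a strip. The factor exp(Bz²) cancels the decay on
    -- the positive half-line, and exp(-iKz²) has modulus one there while growing at angle π/4.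
    set Φ : ℂ → ℂ := fun w =>
      Ψ (Complex.exp w) * Complex.exp ((B - K * Complex.I) * Complex.exp (2 * w))
    have hΦ (w : ℂ) : ‖Φ w‖ = ‖Ψ (Complex.exp w)‖ *
        Real.exp (Real.exp w.re ^ 2 * (B * Real.cos (2 * w.im) + K * Real.sin (2 * w.im))) := by
      rw [norm_mul, norm_exp_mul_exp_two_mul]
    have hd : Differentiable ℂ Φ := by fun_prop
    have hle (w : ℂ) : ‖Φ w‖ ≤ C * Real.exp (Real.exp w.re ^ 2 *
        (A + (B * Real.cos (2 * w.im) + K * Real.sin (2 * w.im)))) := by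
      rw [hΦ]
      have h := hA (Complex.exp w)
      rw [Complex.norm_exp] at h
      calc _ ≤ C * Real.exp (A * Real.exp w.re ^ 2) *
            Real.exp (Real.exp w.re ^ 2 * (B * Real.cos (2 * w.im) + K * Real.sin (2 * w.im))) := by
            gcongr
        _ = _ := by rw [mul_assoc, ← Real.exp_add]; congr 2; ring
    -- The growth is exp(O(e^{2|Re w|})), and θ < π/2 is precisely the admissibility condition 2 <
    -- π/θ.
    have key := PhragmenLindelof.horizontal_strip (f := Φ) (a := 0) (b := θ) (C := C) (z := w)
      hd.diffContOnCl
      ⟨2, by rw [lt_div_iff₀ (by linarith [Real.pi_pos])]; linarith, |A| + (|B| + |K|), by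
        refine IsBigO.of_bound C (Eventually.of_forall fun w => ?_)
        rw [Real.norm_eq_abs, Real.abs_exp]
        refine (hle w).trans (mul_le_mul_of_nonneg_left (Real.exp_le_exp.2 ?_) hC)
        have h1 : A + (B * Real.cos (2 * w.im) + K * Real.sin (2 * w.im)) ≤
            |A| + (|B| + |K|) := by
          have hb : B * Real.cos (2 * w.im) ≤ |B| := by
            refine (le_abs_self _).trans ?_
            rw [abs_mul]
            exact mul_le_of_le_one_right (abs_nonneg _) (Real.abs_cos_le_one _)
          have hk : K * Real.sin (2 * w.im) ≤ |K| := by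
            refine (le_abs_self _).trans ?_
            rw [abs_mul]
            exact mul_le_of_le_one_right (abs_nonneg _) (Real.abs_sin_le_one _)
          linarith [le_abs_self A]
        have h2 : Real.exp w.re ^ 2 ≤ Real.exp (2 * |w.re|) := by
          rw [← Real.exp_nat_mul]
          refine Real.exp_le_exp.2 ?_
          push_cast
          linarith [le_abs_self w.re]
        calc _ ≤ Real.exp w.re ^ 2 * (|A| + (|B| + |K|)) := by gcongr
          _ ≤ Real.exp (2 * |w.re|) * (|A| + (|B| + |K|)) := by gcongr
          _ = _ := mul_comm _ _⟩
      (fun w hw => by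
        have e : Complex.exp w = ((Real.exp w.re : ℝ) : ℂ) := by
          conv_lhs => rw [← Complex.re_add_im w, hw]
          simp
        rw [hΦ, hw, e]
        refine (mul_le_mul_of_nonneg_right (hB _ (Real.exp_pos _)) (Real.exp_pos _).le).trans ?_
        rw [mul_assoc, ← Real.exp_add]
        simp [mul_comm])
      (fun w hw => by
        refine (hle w).trans (mul_le_of_le_one_right hC (Real.exp_le_one_iff.2 ?_))
        rw [hw]
        exact mul_nonpos_of_nonneg_of_nonpos (sq_nonneg _) hθ2.le)
      (by rw [hw]; positivity) (by rw [hw]; exact hθ0.le)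
    rw [hΦ, hw] at key
    have e2 : 2 * (Real.pi / 4) = Real.pi / 2 := by ring
    rwa [e2, Real.cos_pi_div_two, Real.sin_pi_div_two, mul_zero, zero_add, mul_one] at key
  have ray : ∀ t : ℝ, 0 < t → Ψ (t * Complex.exp ((Real.pi / 4 : ℝ) * Complex.I)) = 0 := by
    intro t ht
    by_contra hne
    set w : ℂ := Real.log t + (Real.pi / 4 : ℝ) * Complex.I
    have hw : Complex.exp w = t * Complex.exp ((Real.pi / 4 : ℝ) * Complex.I) := by
      rw [Complex.exp_add, ← Complex.ofReal_exp, Real.exp_log ht]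
    have hre : w.re = Real.log t := by simp [w]
    have him : w.im = Real.pi / 4 := by simp [w]
    have hδ := norm_pos_iff.2 hne
    set δ := ‖Ψ (t * Complex.exp ((Real.pi / 4 : ℝ) * Complex.I))‖
    -- The bound C does not depend on K. This K turns it into δ exp(C/δ) ≤ C, contradicting exp(C/δ)
    -- ≥ C/δ + 1 as δ > 0.
    have h := sector (C / (δ * t ^ 2)) (by positivity) w him
    rw [hw, hre, Real.exp_log ht] at h
    have e : t ^ 2 * (C / (δ * t ^ 2)) = C / δ := by field_simp
    rw [e] at h
    have h1 := Real.add_one_le_exp (C / δ)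
    have h2 : δ * (C / δ + 1) ≤ C := (mul_le_mul_of_nonneg_left h1 hδ.le).trans h
    rw [mul_add, mul_div_cancel₀ _ hδ.ne'] at h2
    linarith
  have hf : ∃ᶠ z in 𝓝[≠] (0 : ℂ), Ψ z = 0 := by
    have ht : Tendsto (fun t : ℝ => (t : ℂ) * Complex.exp ((Real.pi / 4 : ℝ) * Complex.I))
        (𝓝[>] 0) (𝓝[≠] 0) := by
      refine tendsto_nhdsWithin_iff.2 ⟨?_, ?_⟩
      · refine Tendsto.mono_left ?_ nhdsWithin_le_nhds
        refine Continuous.tendsto' (by fun_prop) _ _ (by simp)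
      · filter_upwards [self_mem_nhdsWithin] with t ht
        exact mul_ne_zero (Complex.ofReal_ne_zero.2 (ne_of_gt ht)) (Complex.exp_ne_zero _)
    refine ht.frequently (Eventually.frequently ?_)
    filter_upwards [self_mem_nhdsWithin] with t ht
    exact ray t ht
  have := AnalyticOnNhd.eq_of_frequently_eq (f := Ψ) (g := fun _ => 0)
    (fun z _ => hΨ.analyticAt z) analyticOnNhd_const hf
  exact congrFun this z

/-- Multiplying by exp(τz²) turns the second bound into type q. On the ray where (σ-τ)z² is
positive, the first then gives decay at rate |σ-τ| - p, which exceeds q. -/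
theorem eq_zero_of_two_gaussian_bounds {Φ : ℂ → ℂ} (hΦ : Differentiable ℂ Φ) {p q C₁ C₂ : ℝ}
    {σ τ : ℂ} (hpq : p + q < ‖σ - τ‖)
    (h1 : ∀ z, ‖Φ z‖ ≤ C₁ * Real.exp (p * ‖z‖ ^ 2 - (σ * z ^ 2).re))
    (h2 : ∀ z, ‖Φ z‖ ≤ C₂ * Real.exp (q * ‖z‖ ^ 2 - (τ * z ^ 2).re)) (z : ℂ) : Φ z = 0 := by
  -- Half the argument of σ-τ is rotated away, so that (σ-τ)κ² = |σ-τ|.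
  set κ : ℂ := Complex.exp ((-(σ - τ).arg / 2 : ℝ) * Complex.I)
  have hκ : ‖κ‖ = 1 := Complex.norm_exp_ofReal_mul_I _
  have hκ0 : κ ≠ 0 := Complex.exp_ne_zero _
  have hκ2 : (σ - τ) * κ ^ 2 = (‖σ - τ‖ : ℂ) := by
    conv_lhs => rw [← Complex.norm_mul_exp_arg_mul_I (σ - τ)]
    rw [← Complex.exp_nat_mul, mul_assoc, ← Complex.exp_add]
    have e : (σ - τ).arg * Complex.I +
        (2 : ℕ) * ((-(σ - τ).arg / 2 : ℝ) * Complex.I) = 0 := by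
      push_cast; ring
    rw [e, Complex.exp_zero, mul_one]
  have key := eq_zero_of_gaussian_decay_on_ray
    (Ψ := fun z => Φ (κ * z) * Complex.exp (τ * (κ * z) ^ 2)) (by fun_prop)
    (A := q) (B := ‖σ - τ‖ - p) (C := max C₁ C₂) (by linarith)
    (fun z => by
      rw [norm_mul, Complex.norm_exp]
      calc _ ≤ C₂ * Real.exp (q * ‖κ * z‖ ^ 2 - (τ * (κ * z) ^ 2).re) *
            Real.exp ((τ * (κ * z) ^ 2).re) := by gcongr; exact h2 _
        _ = C₂ * Real.exp (q * ‖z‖ ^ 2) := by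
            rw [mul_assoc, ← Real.exp_add, norm_mul, hκ, one_mul, sub_add_cancel]
        _ ≤ _ := by gcongr; exact le_max_right _ _)
    (fun x hx => by
      rw [norm_mul, Complex.norm_exp]
      have e : -(σ * (κ * x) ^ 2).re + (τ * (κ * x) ^ 2).re = -(‖σ - τ‖ * x ^ 2) := by
        rw [← Complex.neg_re, ← Complex.add_re]
        have : -(σ * (κ * x) ^ 2) + τ * (κ * x) ^ 2 = ((-(‖σ - τ‖ * x ^ 2) : ℝ) : ℂ) := by
          push_cast
          rw [← hκ2]
          ring
        rw [this, Complex.ofReal_re]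
      calc _ ≤ C₁ * Real.exp (p * ‖κ * x‖ ^ 2 - (σ * (κ * x) ^ 2).re) *
            Real.exp ((τ * (κ * x) ^ 2).re) := by gcongr; exact h1 _
        _ = C₁ * Real.exp (-(‖σ - τ‖ - p) * x ^ 2) := by
            rw [mul_assoc, ← Real.exp_add, norm_mul, hκ, one_mul, Complex.norm_real,
              Real.norm_eq_abs, sq_abs]
            congr 2
            linear_combination e
        _ ≤ _ := by gcongr; exact le_max_left _ _)
    (κ⁻¹ * z)
  rw [mul_inv_cancel_left₀ hκ0] at key
  exact (mul_eq_zero.1 key).resolve_right (Complex.exp_ne_zero _)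

/-! ### From Gaussian decay to vanishing -/

/-- Outside a ball the gap a - a' leaves an integrable Gaussian; inside it the weight is bounded and
`g` is locally integrable, being in L². -/
theorem HasGaussianDecay.integrable {n : ℕ} {a a' : ℝ} (haa' : a' < a) {g : L2 n}
    (hg : HasGaussianDecay a g) :
    Integrable fun x : Rn n => ‖g x‖ * Real.exp (a' * ‖x‖ ^ 2) := by
  obtain ⟨C, hC⟩ := hg.bound
  obtain ⟨R, hR⟩ : ∃ R : ℝ, ∀ᵐ x : Rn n, R < ‖x‖ → ‖g x‖ ≤ C * Real.exp (-a * ‖x‖ ^ 2) := by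
    obtain ⟨t₁, h1, t₂, h2, h3⟩ := mem_inf_iff_superset.1 hC
    rw [← comap_norm_atTop] at h1
    obtain ⟨R, -, hR⟩ := (atTop_basis_Ioi.comap norm).mem_iff.1 h1
    refine ⟨R, ?_⟩
    filter_upwards [h2] with x hx hxR
    have h4 : ‖g x‖ ≤ C * ‖Real.exp (-a * ‖x‖ ^ 2)‖ := h3 ⟨hR hxR, hx⟩
    rwa [Real.norm_eq_abs, Real.abs_exp] at h4
  have hgauss : Integrable fun x : Rn n => Real.exp (-(a - a') * ‖x‖ ^ 2) := by
    have h := (GaussianFourier.integrable_cexp_neg_mul_sq_norm_add (V := Rn n)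
      (b := ((a - a' : ℝ) : ℂ)) (by rw [Complex.ofReal_re]; linarith) 0 0).norm
    refine h.congr (Eventually.of_forall fun x => ?_)
    simp only [Complex.norm_exp]
    congr 1
    simp [-Complex.ofReal_sub, ← Complex.ofReal_pow, ← Complex.ofReal_neg, ← Complex.ofReal_mul]
  have hint := ((integrable_norm_mul_exp g 0).const_mul
    (Real.exp ((|a'| + 1 / 2) * R ^ 2))).add (hgauss.const_mul |C|)
  refine hint.mono' ?_ ?_
  · refine (Lp.aestronglyMeasurable g).norm.mul (Continuous.aestronglyMeasurable ?_)
    fun_prop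
  filter_upwards [hR] with x hx
  rw [norm_mul, norm_norm, Real.norm_eq_abs, Real.abs_exp, Pi.add_apply]
  by_cases h : R < ‖x‖
  · refine le_add_of_nonneg_of_le (by positivity) ?_
    calc _ ≤ |C| * Real.exp (-a * ‖x‖ ^ 2) * Real.exp (a' * ‖x‖ ^ 2) := by
          gcongr
          refine (hx h).trans ?_
          gcongr
          exact le_abs_self C
      _ = _ := by rw [mul_assoc, ← Real.exp_add]; congr 2; ring
  · refine le_add_of_le_of_nonneg ?_ (by positivity)
    rw [mul_left_comm, ← Real.exp_add]
    gcongr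
    have h1 : ‖x‖ ^ 2 ≤ R ^ 2 := by gcongr; exact not_lt.1 h
    have h2 : a' * ‖x‖ ^ 2 ≤ |a'| * ‖x‖ ^ 2 := by gcongr; exact le_abs_self a'
    nlinarith [abs_nonneg a']

/-- Completing the square in x: -(a + 1/2)|x|² + 2|Re z||x| is at most 2(Re z)²/(2a+1), and 2(Re z)²
= |z|² + Re z². -/
theorem norm_toDistrib_coherentState_le {n : ℕ} {a : ℝ} (ha : 0 < a) {g : L2 n}
    (hg : Integrable fun x : Rn n => ‖g x‖ * Real.exp (a * ‖x‖ ^ 2)) {η : Rn n} (hη : ‖η‖ = 1)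
    (z : ℂ) :
    ‖toDistrib n g (coherentState η z)‖ ≤ (∫ x, ‖g x‖ * Real.exp (a * ‖x‖ ^ 2)) *
      Real.exp (1 / (2 * a + 1) * ‖z‖ ^ 2 - (((1 - 1 / (2 * a + 1) : ℝ) : ℂ) * z ^ 2).re) := by
  rw [toDistrib_apply, ← integral_mul_const]
  refine norm_integral_le_of_norm_le (hg.mul_const _) (Eventually.of_forall fun x => ?_)
  rw [norm_mul, coherentState_apply, Complex.norm_exp, coherentExponent_re, hη,
    Complex.re_ofReal_mul, mul_comm, mul_assoc ‖g x‖, ← Real.exp_add]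
  gcongr
  have h1 : z.re * inner ℝ x η ≤ |z.re| * ‖x‖ := by
    refine (le_abs_self _).trans ?_
    rw [abs_mul]
    gcongr
    simpa [hη] using abs_real_inner_le_norm x η
  have h2 : ‖z‖ ^ 2 + (z ^ 2).re = 2 * |z.re| ^ 2 := by
    rw [Complex.sq_norm, Complex.normSq_apply, sq_abs, pow_two z, Complex.mul_re]
    ring
  have h3 : 2 * |z.re| * ‖x‖ ≤ (a + 1 / 2) * ‖x‖ ^ 2 + 2 / (2 * a + 1) * |z.re| ^ 2 := by
    have h4 : (a + 1 / 2) * ‖x‖ ^ 2 + 2 / (2 * a + 1) * |z.re| ^ 2 - 2 * |z.re| * ‖x‖ =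
        ((2 * a + 1) * ‖x‖ - 2 * |z.re|) ^ 2 / (2 * (2 * a + 1)) := by
      field_simp
      ring
    have h5 : 0 ≤ ((2 * a + 1) * ‖x‖ - 2 * |z.re|) ^ 2 / (2 * (2 * a + 1)) := by positivity
    linarith
  have h6 : 1 / (2 * a + 1) * (‖z‖ ^ 2 + (z ^ 2).re) = 2 / (2 * a + 1) * |z.re| ^ 2 := by
    rw [h2]; ring
  linarith

/-- With p, q the two fractions, the square of the right side is (p-q)² + 4(1-p)(1-q)sin²(2s).
Subtracting (p-q)² leaves 4pq < 16ab·pq sin²(2s), from 1-p = 2ap and 1-q = 2bq. -/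
theorem add_lt_norm_sub_of_lt {a b s : ℝ} (ha : 0 < a) (hb : 0 < b)
    (h : 1 / 4 < a * b * Real.sin (2 * s) ^ 2) :
    1 / (2 * a + 1) + 1 / (2 * b + 1) < ‖((1 - 1 / (2 * a + 1) : ℝ) : ℂ) -
      ((1 - 1 / (2 * b + 1) : ℝ) : ℂ) * Complex.exp (4 * Complex.I * s)‖ := by
  set p := 1 / (2 * a + 1) with hp
  set q := 1 / (2 * b + 1) with hq
  have hp0 : 0 < p := by positivity
  have hq0 : 0 < q := by positivity
  have hp1 : 1 - p = 2 * a * p := by rw [hp]; field_simp; ring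
  have hq1 : 1 - q = 2 * b * q := by rw [hq]; field_simp; ring
  refine lt_of_pow_lt_pow_left₀ 2 (norm_nonneg _) ?_
  have e : (4 * Complex.I * s : ℂ) = ((2 * (2 * s) : ℝ) : ℂ) * Complex.I := by push_cast; ring
  have hn : ‖((1 - p : ℝ) : ℂ) - ((1 - q : ℝ) : ℂ) * Complex.exp (4 * Complex.I * s)‖ ^ 2 =
      (p - q) ^ 2 + 4 * ((1 - p) * (1 - q)) * Real.sin (2 * s) ^ 2 := by
    rw [e, Complex.exp_mul_I, ← Complex.ofReal_cos, ← Complex.ofReal_sin, Complex.sq_norm,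
      Complex.normSq_apply]
    simp only [Complex.sub_re, Complex.sub_im, Complex.re_ofReal_mul, Complex.im_ofReal_mul,
      Complex.add_re, Complex.add_im, Complex.ofReal_re, Complex.ofReal_im, Complex.mul_I_re,
      Complex.mul_I_im]
    have h1 := Real.sin_sq_add_cos_sq (2 * (2 * s))
    have h2 : Real.cos (2 * (2 * s)) = 1 - 2 * Real.sin (2 * s) ^ 2 := by
      rw [Real.cos_two_mul, Real.cos_sq']; ring
    linear_combination (1 - q) ^ 2 * h1 - 2 * (1 - p) * (1 - q) * h2
  rw [hn, hp1, hq1]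
  have h3 : 0 < p * q := by positivity
  nlinarith

theorem coherentState_smul {n : ℕ} (r : ℝ) (η : Rn n) (z : ℂ) :
    coherentState (r • η) z = coherentState η (z * r) := by
  ext x
  rw [coherentState_apply, coherentState_apply, coherentExponent, coherentExponent,
    inner_smul_right, norm_smul, mul_pow, Real.norm_eq_abs, sq_abs]
  congr 1
  push_cast
  ring

/-- Uniqueness from Gaussian decay at two times, with the decay expressed by integrability. -/
theorem eq_zero_of_integrable_mul_exp {n : ℕ} (hn : 1 ≤ n) {f : L2 n} {a b s : ℝ} (ha : 0 < a)
    (hb : 0 < b) (hf : Integrable fun x : Rn n => ‖f x‖ * Real.exp (a * ‖x‖ ^ 2))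
    (hu : Integrable fun x : Rn n => ‖hermitePropagator n s f x‖ * Real.exp (b * ‖x‖ ^ 2))
    (h : 1 / 4 < a * b * Real.sin (2 * s) ^ 2) : f = 0 := by
  have key (η : Rn n) (hη : ‖η‖ = 1) (z : ℂ) : toDistrib n f (coherentState η z) = 0 := by
    refine eq_zero_of_two_gaussian_bounds
      (C₂ := ∫ x, ‖hermitePropagator n s f x‖ * Real.exp (b * ‖x‖ ^ 2))
      (Φ := fun z => toDistrib n f (coherentState η z))
      (fun z => (hasDerivAt_toDistrib_coherentState f η z).differentiableAt)
      (add_lt_norm_sub_of_lt ha hb h)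
      (fun z => norm_toDistrib_coherentState_le ha hf hη z) (fun z => ?_) z
    -- Evaluating the later-time transform at e^{2is}z brings the transform of `f` back to z;
    -- squaring the rotated variable yields the factor e^{4is}.
    have h1 := norm_toDistrib_coherentState_le hb hu hη (Complex.exp (2 * Complex.I * s) * z)
    have h2 := pairing_hermitePropagator_coherentState f η (Complex.exp (2 * Complex.I * s) * z) s
    rw [← mul_assoc, ← Complex.exp_add, neg_add_cancel, Complex.exp_zero, one_mul] at h2
    have h3 : ‖Complex.exp (2 * Complex.I * s)‖ = 1 := by rw [Complex.norm_exp]; simp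
    have h4 : ‖Complex.exp (-(Complex.I * s * n))‖ = 1 := by rw [Complex.norm_exp]; simp
    rw [pairing_apply, pairing_apply] at h2
    rw [h2, norm_mul, norm_mul, h3, h4, one_mul, one_mul, mul_pow, ← Complex.exp_nat_mul] at h1
    have h5 : ((2 : ℕ) : ℂ) * (2 * Complex.I * s) = 4 * Complex.I * s := by push_cast; ring
    rwa [h5, ← mul_assoc] at h1
  refine eq_zero_of_toDistrib_coherentState_I f fun ξ => ?_
  obtain ⟨r, η, hη, rfl⟩ : ∃ (r : ℝ) (η : Rn n), ‖η‖ = 1 ∧ ξ = r • η := by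
    by_cases hξ : ξ = 0
    -- A unit vector is needed even for ξ = 0; it exists since n ≥ 1.
    · exact ⟨0, EuclideanSpace.single ⟨0, hn⟩ 1, by simp, by simp [hξ]⟩
    · exact ⟨‖ξ‖, ‖ξ‖⁻¹ • ξ, norm_smul_inv_norm hξ, by
        rw [smul_smul, mul_inv_cancel₀ (norm_ne_zero_iff.2 hξ), one_smul]⟩
  rw [coherentState_smul]
  exact key η hη _

/-- The midpoint of 1 and 1/(4P) works: its square exceeds their product, by AM–GM. -/
theorem exists_scaling_lt {P : ℝ} (hP : 1 / 4 < P) : ∃ t : ℝ, 0 < t ∧ t < 1 ∧ 1 / 4 < t ^ 2 * P := by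
  have hP0 : 0 < P := by linarith
  refine ⟨(1 + 1 / (4 * P)) / 2, by positivity, ?_, ?_⟩
  · have : 1 / (4 * P) < 1 := by rw [div_lt_one (by positivity)]; linarith
    linarith
  · have e : ((1 + 1 / (4 * P)) / 2) ^ 2 * P - 1 / 4 = (4 * P - 1) ^ 2 / (64 * P) := by
      field_simp
      ring
    have h1 : 0 < (4 * P - 1) ^ 2 / (64 * P) := by
      have : 0 < 4 * P - 1 := by linarith
      positivity
    linarith

end

theorem mainTheorem5 (n : ℕ) (hn : 1 ≤ n) (f : L2 n) :
    (IsSchrodingerSolution f (fun s => hermiteSchrodinger n s f) ∧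
      ∀ v : ℝ → L2 n, IsSchrodingerSolution f v → ∀ s, v s = hermiteSchrodinger n s f) ∧
    ∀ a b s₀ : ℝ, 0 < a → 0 < b →
      HasGaussianDecay a f →
      HasGaussianDecay b (hermiteSchrodinger n s₀ f) →
      1 / 4 < a * b * Real.sin (2 * s₀) ^ 2 →
      ∀ s : ℝ, hermiteSchrodinger n s f = 0 := by
  refine ⟨⟨isSchrodingerSolution_hermiteSchrodinger f, fun v hv s =>
    (isSchrodingerSolution_hermiteSchrodinger f).eq hv s⟩, ?_⟩
  intro a b s₀ ha hb hf hu h s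
  obtain ⟨t, ht0, ht1, ht⟩ := exists_scaling_lt h
  -- Both rates are shrunk by t < 1 to gain integrability; their product loses t², which the strict
  -- hypothesis can afford.
  have hf0 : f = 0 := eq_zero_of_integrable_mul_exp hn (a := t * a) (b := t * b) (s := s₀)
    (by positivity) (by positivity) (hf.integrable (by nlinarith)) (hu.integrable (by nlinarith))
    (by linarith)
  rw [← hermitePropagator_apply, hf0, map_zero]
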